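/- All graphs are finite and simple. For graphs $H,G$ write $H\prec G$ if $H$ is isomorphic to an induced subgraph of $G$. For a (possibly infinite) family $\mathcal H$ of graphs, $G$ is $\mathcal H$-free if there is no $H\in\mathcal H$ with $H\prec G$; and $\mathcal H_1\le\mathcal H_2$ means that for every $H_2\in\mathcal H_2$ there is $H_1\in\mathcal H_1$ with $H_1\prec H_2$. For a graph parameter $\mu$, let $B\text{-}\mu$ be the class of all families $\mathcal H$ for which there is a constant $c$ such that $\mu(G)<c$ for every connected $\mathcal H$-free graph $G$. For a graph $G=(V,E)$ let $N[v]$ be the closed neighborhood of $v$ and $N[S]=\bigcup_{v\in S}N[v]$. A set $S\subseteq V$ is dominating if $N[S]=V$, and irredundant if $N[s]\setminus N[S\setminus\{s\}]\neq\emptyset$ for every $s\in S$. Let $ir(G)$ and $IR(G)$ be the minimum and maximum size of an inclusion-maximal irredundant set of $G$, let $i(G)$ be the minimum size of an inclusion-maximal independent set, and let $\Gamma(G)$ be the maximum size of an inclusion-minimal dominating set. Let $P_n$ be the path on $n$ vertices, $K_n$ the complete graph on $n$ vertices, and $K_{s,t}$ the complete bipartite graph with parts of sizes $s$ and $t$.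 Let $K_{1,n}^*$ be obtained from $K_{1,n}$ by adding a pendant vertex to each of its $n$ leaves; $K_n^*$ from $K_n$ by adding a pendant vertex to each vertex; $CK_n$ from two disjoint copies of $K_n$ by adding a perfect matching between them; and $BS_n$ from two disjoint copies of $K_{1,n}$ by joining their centers by an edge. Theorem. Let $\mathcal H$ be a family of graphs. (1) $\mathcal H\in B\text{-}ir$ if and only if $\mathcal H\le\{K_{1,n}^*,K_n^*,P_n\}$ for some positive integer $n$. (2) $\mathcal H\in B\text{-}i$ if and only if $\mathcal H\le\{K_{1,n}^*,K_n^*,P_n,K_{n,n},BS_n\}$ for some positive integer $n$. (3) The following are equivalent: $\mathcal H\in B\text{-}IR$; $\mathcal H\in B\text{-}\Gamma$; $\mathcal H\le\{K_{1,n},K_n^*,P_n,CK_n\}$ for some positive integer $n$. -/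

import Mathlib

namespace DominationChain

/-! ## Finite graphs, families of graphs, forbidden induced subgraphs -/

/-- A finite simple graph (on a vertex set in `Type`; every finite graph is isomorphic to one). -/
structure FinGraph : Type 1 where
  /-- the vertex set -/
  V : Type
  /-- the vertex set is finite -/
  finite : Finite V
  /-- the graph itself -/
  graph : SimpleGraph V

/-- A graph on a finite vertex set, as a finite graph. -/
def FinGraph.of {V : Type} [h : Finite V] (G : SimpleGraph V) : FinGraph := ⟨V, h, G⟩

/-- `H₁ ≺ H₂`: `H₁` is (isomorphic to) an induced subgraph of `H₂`. -/
def Prec (H₁ H₂ : FinGraph) : Prop := H₁.graph.IsIndContained H₂.graph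

/-- `G` is `ℋ`-free: no member of `ℋ` is an induced subgraph of `G`. -/
def IsFree (ℋ : Set FinGraph) (G : FinGraph) : Prop := ¬ ∃ H ∈ ℋ, Prec H G

/-- `ℋ₁ ≤ ℋ₂` for families of graphs: each member of `ℋ₂` has an induced subgraph in `ℋ₁`. -/
def FamilyLE (ℋ₁ ℋ₂ : Set FinGraph) : Prop := ∀ H₂ ∈ ℋ₂, ∃ H₁ ∈ ℋ₁, Prec H₁ H₂

/-- `B-μ`: the families `ℋ` for which some constant `c` satisfies `μ(G) < c` for every connected
`ℋ`-free graph `G`. -/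
def boundedFamilies (μ : FinGraph → ℕ) : Set (Set FinGraph) :=
  {ℋ | ∃ c : ℕ, ∀ G : FinGraph, G.graph.Connected → IsFree ℋ G → μ G < c}

/-! ## Parameters of the domination chain -/

section Parameters

variable {V : Type}

/-- The closed neighbourhood `N[v]` of a vertex. -/
def closedNbhd (G : SimpleGraph V) (v : V) : Set V := insert v (G.neighborSet v)

/-- The closed neighbourhood `N[S]` of a set of vertices. -/
def closedNbhdSet (G : SimpleGraph V) (S : Set V) : Set V := ⋃ v ∈ S, closedNbhd G v

/-- `S` is a dominating set: `N[S]` is the whole vertex set. -/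
def IsDominating (G : SimpleGraph V) (S : Set V) : Prop := closedNbhdSet G S = Set.univ

/-- The private neighbourhood `PN[v, S] = N[v] - N[S - {v}]`. -/
def privateNbhd (G : SimpleGraph V) (v : V) (S : Set V) : Set V :=
  closedNbhd G v \ closedNbhdSet G (S \ {v})

/-- `S` is irredundant: each of its vertices has a private neighbour. -/
def IsIrredundant (G : SimpleGraph V) (S : Set V) : Prop :=
  ∀ s ∈ S, (privateNbhd G s S).Nonempty

end Parameters

/-- The lower irredundance number: least size of a maximal irredundant set. -/
noncomputable def ir (G : FinGraph) : ℕ :=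
  sInf {k | ∃ S : Set G.V, Maximal (IsIrredundant G.graph) S ∧ S.ncard = k}

/-- The independence domination number: least size of a maximal independent set. -/
noncomputable def indepDom (G : FinGraph) : ℕ :=
  sInf {k | ∃ S : Set G.V, Maximal G.graph.IsIndepSet S ∧ S.ncard = k}

/-- The upper domination number: largest size of a minimal dominating set. -/
noncomputable def upperDom (G : FinGraph) : ℕ :=
  sSup {k | ∃ S : Set G.V, Minimal (IsDominating G.graph) S ∧ S.ncard = k}

/-- The upper irredundance number: largest size of a maximal irredundant set. -/
noncomputable def upperIR (G : FinGraph) : ℕ :=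
  sSup {k | ∃ S : Set G.V, Maximal (IsIrredundant G.graph) S ∧ S.ncard = k}

/-! ## The special graphs -/

/-- The graph obtained from `G` by adding, for each `i : ι`, a new vertex whose only neighbour is
`f i`. -/
def addPendants {V ι : Type} (G : SimpleGraph V) (f : ι → V) : SimpleGraph (V ⊕ ι) where
  Adj
    | .inl u, .inl v => G.Adj u v
    | .inl u, .inr i => u = f i
    | .inr i, .inl u => u = f i
    | .inr _, .inr _ => False
  symm := ⟨by
    rintro (u | i) (v | j) h
    · exact G.symm.symm _ _ h
    · exact h
    · exact h
    · exact h⟩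
  loopless := ⟨by
    rintro (u | i) h
    · exact G.loopless.irrefl u h
    · exact h⟩

/-- The path `P_n` on `n` vertices. -/
def pathG (n : ℕ) : FinGraph := .of (SimpleGraph.pathGraph n)

/-- The star `K_{1,n}`. -/
def starG (n : ℕ) : FinGraph := .of (completeBipartiteGraph (Fin 1) (Fin n))

/-- The balanced complete bipartite graph `K_{n,n}`. -/
def bicliqueG (n : ℕ) : FinGraph := .of (completeBipartiteGraph (Fin n) (Fin n))

/-- `K_{1,n}^*`: the star `K_{1,n}` with a pendant vertex added to each of its `n` leaves. -/
def starPendantG (n : ℕ) : FinGraph :=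
  .of (addPendants (completeBipartiteGraph (Fin 1) (Fin n)) (Sum.inr : Fin n → Fin 1 ⊕ Fin n))

/-- `K_n^*`: the complete graph `K_n` with a pendant vertex added to each vertex. -/
def cliquePendantG (n : ℕ) : FinGraph :=
  .of (addPendants (SimpleGraph.completeGraph (Fin n)) (id : Fin n → Fin n))

/-- `CK_n`: two disjoint copies of `K_n` joined by a perfect matching. The vertex `(b, i)` is
vertex `i` of copy `b`. -/
def matchedCliquesG (n : ℕ) : FinGraph :=
  .of (SimpleGraph.fromRel fun x y : Fin 2 × Fin n => x.1 = y.1 ∨ x.2 = y.2)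

/-- The bistar `BS_n`: two disjoint stars `K_{1,n}` with their centres joined by an edge; that is,
an edge with `n` pendant vertices added at each of its two ends. -/
def bistarG (n : ℕ) : FinGraph :=
  .of (addPendants (SimpleGraph.completeGraph (Fin 2)) (Prod.fst : Fin 2 × Fin n → Fin 2))

end DominationChain

/-!
Each of the three characterisations has an easy and a hard direction.

If `ℋ ∈ B-μ` with constant `c`, a special graph that is connected and has `μ ≥ c` is not `ℋ`-free,
so it suffices that `μ` is unbounded on each of the special sequences. For most of them this comes
from a packing (vertices with disjoint closed neighbourhoods), which bounds the size of every
dominating set from below; for `ir` one uses in addition that a maximal irredundant set and one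
private neighbour of each of its vertices together dominate, so that `γ ≤ 2 ir`.

Conversely, the parameter has to be bounded on connected graphs without the special induced
subgraphs. Excluding `P_n` leaves fewer than `n` distance layers around a vertex
(`dist_lt_of_not_path`), and Ramsey's theorem is applied to vertices of one layer and their parents
in the layer before (`exists_star_or_matching`).

* For `ir ≤ γ`: a layer that is not dominated by few vertices contains many independent vertices
  matched into the previous layer without further adjacencies (`exists_matched_pairs`). The partners
  form a clique, which gives `K_n^*`, or an independent set. In the latter case passing to parents
  repeatedly gives `K_n^*` or a parent adjacent to many ends of an induced matching, hence
  `K_{1,n}^*` (`starPendant_or_cliquePendant_of_matching`), as the first layer is a single vertex.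
* For `i`: by the previous point there is a small dominating set `D`. Choose an independent `D₀ ⊆ D`
  greedily by decreasing independence number of the neighbourhood, and extend it to a maximal
  independent set `I`. The vertices of `I` outside `D₀` lie in sets `N(w) \ N[v]` with `w ∈ D` and
  `v ∈ D₀` adjacent to `w` and chosen before it; such sets have bounded independence number
  (`exists_indep_private_bound`).
* For `Γ ≤ IR`: a large irredundant set contains a large clique, which together with private
  neighbours gives `CK_n` or `K_n^*`, or a large independent set, from which `K_{1,n}` or `K_n^*` is
  found by passing to parents (`star_or_cliquePendant_of_indep`).
-/

namespace DominationChain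

/-! ### Ramsey's theorem for relations on an ordered index set -/

/-- Ramsey's theorem for two colours, for the pairs `i < j` of a finite set of natural numbers. -/
theorem ramsey_finset (a b : ℕ) : ∃ N : ℕ, ∀ (s : Finset ℕ) (r : ℕ → ℕ → Prop), N ≤ s.card →
    (∃ t ⊆ s, t.card = a ∧ ∀ i ∈ t, ∀ j ∈ t, i < j → r i j) ∨
    (∃ t ⊆ s, t.card = b ∧ ∀ i ∈ t, ∀ j ∈ t, i < j → ¬ r i j) := by
  classical
  induction a generalizing b with
  | zero => exact ⟨0, fun s r _ => .inl ⟨∅, by simp⟩⟩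
  | succ a iha =>
    induction b with
    | zero => exact ⟨0, fun s r _ => .inr ⟨∅, by simp⟩⟩
    | succ b ihb =>
      obtain ⟨N₁, h₁⟩ := iha (b + 1)
      obtain ⟨N₂, h₂⟩ := ihb
      refine ⟨N₁ + N₂ + 1, fun s r hs => ?_⟩
      have hne : s.Nonempty := Finset.card_pos.mp (by omega)
      -- Split the remaining indices by the colour of their pair with the least index.
      set v := s.min' hne with hv
      have hlt : ∀ j ∈ s.erase v, v < j := fun j hj =>
        lt_of_le_of_ne (Finset.min'_le _ _ (Finset.mem_of_mem_erase hj))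
          (Finset.ne_of_mem_erase hj).symm
      have hvs : v ∈ s := Finset.min'_mem _ _
      have hcard := Finset.card_filter_add_card_filter_not (s := s.erase v) (fun j => r v j)
      rw [Finset.card_erase_of_mem hvs] at hcard
      have hsub : ∀ (p : ℕ → Prop) [DecidablePred p], (s.erase v).filter p ⊆ s := fun p _ =>
        (Finset.filter_subset _ _).trans (Finset.erase_subset _ _)
      have key : ∀ (q : ℕ → ℕ → Prop) (t : Finset ℕ) (k : ℕ),
          t ⊆ s.erase v → (∀ j ∈ t, q v j) → t.card = k →
          (∀ i ∈ t, ∀ j ∈ t, i < j → q i j) →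
          ∃ t ⊆ s, t.card = k + 1 ∧ ∀ i ∈ t, ∀ j ∈ t, i < j → q i j := by
        intro q t k hts htv htc htr
        have hlt' : ∀ j ∈ t, v < j := fun j hj => hlt j (hts hj)
        refine ⟨insert v t, Finset.insert_subset hvs (hts.trans (Finset.erase_subset _ _)), ?_, ?_⟩
        · rw [Finset.card_insert_of_notMem (fun h => lt_irrefl _ (hlt' v h)), htc]
        · intro i hi j hj hij
          rcases Finset.mem_insert.mp hi with rfl | hi
          · rcases Finset.mem_insert.mp hj with rfl | hj
            · exact absurd hij (lt_irrefl _)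
            · exact htv j hj
          · rcases Finset.mem_insert.mp hj with rfl | hj
            · exact absurd hij (hlt' i hi).not_gt
            · exact htr i hi j hj hij
      by_cases hc : N₁ ≤ ((s.erase v).filter (fun j => r v j)).card
      · rcases h₁ _ r hc with ⟨t, hts, htc, htr⟩ | ⟨t, hts, h⟩
        · exact .inl (key r t a (hts.trans (Finset.filter_subset _ _))
            (fun j hj => (Finset.mem_filter.mp (hts hj)).2) htc htr)
        · exact .inr ⟨t, hts.trans (hsub _), h⟩
      · rcases h₂ ((s.erase v).filter (fun j => ¬ r v j)) r (by omega) with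
          ⟨t, hts, h⟩ | ⟨t, hts, htc, htr⟩
        · exact .inl ⟨t, hts.trans (hsub _), h⟩
        · exact .inr (key (fun i j => ¬ r i j) t b (hts.trans (Finset.filter_subset _ _))
            (fun j hj => (Finset.mem_filter.mp (hts hj)).2) htc htr)

/-- Ramsey's theorem for index sets `Fin N`: a long index set has a subsequence of prescribed
length on which a given relation holds for all pairs `i < j` or for none. -/
theorem ramsey (m : ℕ) : ∃ N : ℕ, ∀ r : Fin N → Fin N → Prop, ∃ f : Fin m → Fin N, StrictMono f ∧
    ((∀ i j, i < j → r (f i) (f j)) ∨ (∀ i j, i < j → ¬ r (f i) (f j))) := by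
  obtain ⟨N, hN⟩ := ramsey_finset m m
  refine ⟨N, fun r => ?_⟩
  have conv : ∀ (q : Fin N → Fin N → Prop) (t : Finset ℕ), t ⊆ Finset.range N → t.card = m →
      (∀ i ∈ t, ∀ j ∈ t, i < j → ∃ hi hj, q ⟨i, hi⟩ ⟨j, hj⟩) →
      ∃ f : Fin m → Fin N, StrictMono f ∧ ∀ i j, i < j → q (f i) (f j) := by
    intro q t hts htc htr
    let g := t.orderEmbOfFin htc
    have hg : ∀ i, g i ∈ t := fun i => t.orderEmbOfFin_mem htc i
    refine ⟨fun i => ⟨g i, Finset.mem_range.mp (hts (hg i))⟩,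
      fun i j hij => g.strictMono hij, fun i j hij => ?_⟩
    obtain ⟨_, _, h⟩ := htr _ (hg i) _ (hg j) (g.strictMono hij)
    exact h
  rcases hN (Finset.range N) (fun i j => ∃ hi hj, r ⟨i, hi⟩ ⟨j, hj⟩) (by simp) with
    ⟨t, hts, htc, htr⟩ | ⟨t, hts, htc, htr⟩
  · obtain ⟨f, hf, h⟩ := conv r t hts htc htr
    exact ⟨f, hf, .inl h⟩
  · obtain ⟨f, hf, h⟩ := conv (fun i j => ¬ r i j) t hts htc fun i hi j hj hij =>
      ⟨Finset.mem_range.mp (hts hi), Finset.mem_range.mp (hts hj),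
        fun h => htr i hi j hj hij ⟨_, _, h⟩⟩
    exact ⟨f, hf, .inr h⟩

/-- Ramsey's theorem for the vertices of a graph, listed as a family. -/
theorem ramsey_adj (m : ℕ) : ∃ N : ℕ, ∀ {V : Type} (G : SimpleGraph V) (x : Fin N → V),
    ∃ f : Fin m → Fin N, StrictMono f ∧
    ((∀ i j, i ≠ j → G.Adj (x (f i)) (x (f j))) ∨ (∀ i j, ¬ G.Adj (x (f i)) (x (f j)))) := by
  obtain ⟨N, hN⟩ := ramsey m
  refine ⟨N, fun G x => ?_⟩
  obtain ⟨f, hf, h | h⟩ := hN fun i j => G.Adj (x i) (x j)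
  · refine ⟨f, hf, .inl fun i j hij => ?_⟩
    rcases lt_or_gt_of_ne hij with hij | hij
    exacts [h i j hij, (h j i hij).symm]
  · refine ⟨f, hf, .inr fun i j hadj => ?_⟩
    rcases lt_trichotomy i j with hij | rfl | hij
    exacts [h i j hij hadj, G.irrefl hadj, h j i hij hadj.symm]

/-- A Ramsey theorem for ordered pairs of distinct indices: on a subsequence of prescribed length,
a relation holds for all pairs above the diagonal, or for all pairs below the diagonal, or for no
pair off the diagonal. -/
theorem ramsey_off_diagonal (m : ℕ) : ∃ N : ℕ, ∀ r : Fin N → Fin N → Prop,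
    ∃ f : Fin m → Fin N, StrictMono f ∧
    ((∀ i j, i < j → r (f i) (f j)) ∨ (∀ i j, i < j → r (f j) (f i)) ∨
      (∀ i j, i ≠ j → ¬ r (f i) (f j))) := by
  obtain ⟨N₁, h₁⟩ := ramsey m
  obtain ⟨N, h⟩ := ramsey N₁
  refine ⟨N, fun r => ?_⟩
  obtain ⟨f, hf, hfr⟩ := h r
  obtain ⟨g, hg, hgr⟩ := h₁ fun i j => r (f j) (f i)
  refine ⟨f ∘ g, hf.comp hg, ?_⟩
  rcases hfr with hfr | hfr
  · exact .inl fun i j hij => hfr _ _ (hg hij)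
  rcases hgr with hgr | hgr
  · exact .inr (.inl hgr)
  refine .inr (.inr fun i j hij => ?_)
  rcases lt_or_gt_of_ne hij with hij | hij
  exacts [hfr _ _ (hg hij), hgr _ _ hij]

/-! ### Recognising the special graphs as induced subgraphs -/

section Recognition

variable {V : Type} {G : SimpleGraph V} {n : ℕ}

theorem isIndContained_of_map {W : Type} {H : SimpleGraph W} (f : W → V)
    (hf : Function.Injective f) (h : ∀ a b, G.Adj (f a) (f b) ↔ H.Adj a b) :
    H.IsIndContained G :=
  ⟨⟨⟨f, hf⟩, h _ _⟩⟩

theorem star_isIndContained (v : V) (x : Fin n → V) (hx : Function.Injective x)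
    (hxx : ∀ i j, ¬ G.Adj (x i) (x j)) (hv : ∀ i, G.Adj v (x i)) :
    (starG n).graph.IsIndContained G := by
  refine isIndContained_of_map (H := completeBipartiteGraph (Fin 1) (Fin n))
    (Sum.elim (fun _ => v) x) ?_ ?_
  · rintro (i | i) (j | j) h
    · exact congrArg _ (Subsingleton.elim i j)
    · exact absurd (hv j) (by simp_all)
    · exact absurd (hv i) (by simp_all)
    · exact congrArg _ (hx h)
  · rintro (i | i) (j | j) <;>
      simp_all [completeBipartiteGraph, G.adj_comm (x _) v]

theorem biclique_isIndContained (y z : Fin n → V) (hy : Function.Injective y)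
    (hz : Function.Injective z) (hyy : ∀ i j, ¬ G.Adj (y i) (y j))
    (hzz : ∀ i j, ¬ G.Adj (z i) (z j)) (hyz : ∀ i j, G.Adj (y i) (z j)) :
    (bicliqueG n).graph.IsIndContained G := by
  refine isIndContained_of_map (H := completeBipartiteGraph (Fin n) (Fin n))
    (Sum.elim y z) ?_ ?_
  · rintro (i | i) (j | j) h
    · exact congrArg _ (hy h)
    · exact absurd (hyz i j) (by simp_all)
    · exact absurd (hyz j i) (by simp_all)
    · exact congrArg _ (hz h)
  · rintro (i | i) (j | j) <;>
      simp_all [completeBipartiteGraph, G.adj_comm (z _) (y _)]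

theorem cliquePendant_isIndContained (q x : Fin n → V) (hqq : ∀ i j, i ≠ j → G.Adj (q i) (q j))
    (hxx : ∀ i j, ¬ G.Adj (x i) (x j)) (hqx : ∀ i j, G.Adj (q i) (x j) ↔ i = j) :
    (cliquePendantG n).graph.IsIndContained G := by
  have hne : ∀ i j, q i ≠ x j := fun i j h => hxx j i (h ▸ (hqx i i).mpr rfl)
  refine isIndContained_of_map (H := addPendants (SimpleGraph.completeGraph (Fin n)) (id : Fin n → Fin n))
    (Sum.elim q x) ?_ ?_
  · rintro (i | i) (j | j) h
    · by_contra hij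
      exact G.ne_of_adj (hqq i j fun h => hij (congrArg _ h)) h
    · exact absurd h (hne i j)
    · exact absurd h.symm (hne j i)
    · exact congrArg _ (((hqx i j).mp (((show x i = x j from h) ▸ (hqx i i).mpr rfl))))
  · rintro (i | i) (j | j)
    · exact ⟨fun h hij => G.irrefl (hij ▸ h), fun h => hqq i j h⟩
    · exact hqx i j
    · exact (G.adj_comm _ _).trans (hqx j i)
    · exact iff_of_false (hxx i j) id

theorem starPendant_isIndContained (v : V) (p x : Fin n → V) (hpp : ∀ i j, ¬ G.Adj (p i) (p j))
    (hxx : ∀ i j, ¬ G.Adj (x i) (x j)) (hpx : ∀ i j, G.Adj (p i) (x j) ↔ i = j)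
    (hvp : ∀ i, G.Adj v (p i)) (hvx : ∀ i, ¬ G.Adj v (x i)) (hvx' : ∀ i, v ≠ x i) :
    (starPendantG n).graph.IsIndContained G := by
  have hne : ∀ i j, p i ≠ x j := fun i j h => hvx j (h ▸ hvp i)
  refine isIndContained_of_map (H := addPendants (completeBipartiteGraph (Fin 1) (Fin n))
    (Sum.inr : Fin n → Fin 1 ⊕ Fin n))
    (Sum.elim (Sum.elim (fun _ => v) p) x) ?_ ?_
  · rintro ((i | i) | i) ((j | j) | j) h
    · exact congrArg _ (congrArg _ (Subsingleton.elim i j))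
    · exact absurd h (hvp j).ne
    · exact absurd h (hvx' j)
    · exact absurd h.symm (hvp i).ne
    · exact congrArg _ (congrArg _ ((hpx i j).mp
        ((show p i = p j from h) ▸ (hpx j j).mpr rfl)))
    · exact absurd h (hne i j)
    · exact absurd h.symm (hvx' i)
    · exact absurd h.symm (hne j i)
    · exact congrArg _ (((hpx i j).mp (((show x i = x j from h) ▸ (hpx i i).mpr rfl))))
  · rintro ((i | i) | i) ((j | j) | j) <;>
      simp_all [completeBipartiteGraph, addPendants,
        G.adj_comm (p _) v, G.adj_comm (x _) v, G.adj_comm (x _) (p _)]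

theorem matchedCliques_isIndContained (s t : Fin n → V) (hss : ∀ i j, i ≠ j → G.Adj (s i) (s j))
    (htt : ∀ i j, i ≠ j → G.Adj (t i) (t j)) (hst : ∀ i j, G.Adj (s i) (t j) ↔ i = j)
    (hne : ∀ i j, s i ≠ t j) :
    (matchedCliquesG n).graph.IsIndContained G := by
  have hs : Function.Injective s := fun i j h => by
    by_contra hij; exact (hss i j hij).ne h
  have ht : Function.Injective t := fun i j h => by
    by_contra hij; exact (htt i j hij).ne h
  have hss' : ∀ i j, G.Adj (s i) (s j) ↔ i ≠ j :=
    fun i j => ⟨fun h hij => G.irrefl (hij ▸ h), hss i j⟩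
  have htt' : ∀ i j, G.Adj (t i) (t j) ↔ i ≠ j :=
    fun i j => ⟨fun h hij => G.irrefl (hij ▸ h), htt i j⟩
  refine isIndContained_of_map (H := SimpleGraph.fromRel fun x y : Fin 2 × Fin n => x.1 = y.1 ∨ x.2 = y.2)
    (fun a => if a.1 = 0 then s a.2 else t a.2) ?_ ?_
  · rintro ⟨a, i⟩ ⟨b, j⟩ h
    fin_cases a <;> fin_cases b
    · exact congrArg _ (hs h)
    · exact absurd h (hne i j)
    · exact absurd h.symm (hne j i)
    · exact congrArg _ (ht h)
  · rintro ⟨a, i⟩ ⟨b, j⟩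
    fin_cases a <;> fin_cases b <;>
      simp [hss', htt', hst, G.adj_comm (t _) (s _), eq_comm]

theorem bistar_isIndContained (u w : V) (y z : Fin n → V) (huw : G.Adj u w)
    (hy : Function.Injective y) (hz : Function.Injective z)
    (huy : ∀ i, G.Adj u (y i)) (hwz : ∀ i, G.Adj w (z i)) (huz : ∀ i, ¬ G.Adj u (z i))
    (hwy : ∀ i, ¬ G.Adj w (y i)) (hyy : ∀ i j, ¬ G.Adj (y i) (y j))
    (hzz : ∀ i j, ¬ G.Adj (z i) (z j)) (hyz : ∀ i j, ¬ G.Adj (y i) (z j)) :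
    (bistarG n).graph.IsIndContained G := by
  have h₁ : ∀ i, u ≠ z i := fun i h => hyz i i (h ▸ (huy i).symm)
  have h₂ : ∀ i, w ≠ y i := fun i h => hyz i i (h ▸ hwz i)
  have h₃ : ∀ i j, y i ≠ z j := fun i j h => huz j (h ▸ huy i)
  have h₄ := fun i => (huy i).ne
  have h₅ := fun i => (hwz i).ne
  have h₆ := huw.ne
  refine isIndContained_of_map (H := addPendants (SimpleGraph.completeGraph (Fin 2))
    (Prod.fst : Fin 2 × Fin n → Fin 2))
    (Sum.elim (fun a => if a = 0 then u else w)
    (fun a => if a.1 = 0 then y a.2 else z a.2)) ?_ ?_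
  · rintro (a | ⟨a, i⟩) (b | ⟨b, j⟩) h <;> fin_cases a <;> fin_cases b <;>
      simp_all [hy.eq_iff, hz.eq_iff, eq_comm]
  · rintro (a | ⟨a, i⟩) (b | ⟨b, j⟩) <;> fin_cases a <;> fin_cases b <;>
      simp_all [addPendants, G.adj_comm (y _) u, G.adj_comm (z _) u,
        G.adj_comm w u, G.adj_comm (y _) w, G.adj_comm (z _) w, G.adj_comm (z _) (y _)]

end Recognition

/-! ### Distance layers of a connected graph -/

section Layers

variable {V : Type} {G : SimpleGraph V}

theorem exists_adj_dist_eq (hG : G.Connected) {r v : V} {d : ℕ} (h : G.dist r v = d + 1) :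
    ∃ u, G.Adj u v ∧ G.dist r u = d := by
  obtain ⟨p, hp⟩ := hG.exists_walk_length_eq_dist v r
  rw [G.dist_comm, h] at hp
  cases p with
  | nil => simp at hp
  | @cons _ u _ hvu q =>
    refine ⟨u, hvu.symm, le_antisymm ?_ ?_⟩
    · rw [G.dist_comm]
      exact (SimpleGraph.dist_le q).trans (by simpa using hp.le)
    · have := hG.dist_triangle (u := r) (v := u) (w := v)
      rw [h, (SimpleGraph.dist_eq_one_iff_adj).mpr hvu.symm] at this
      omega

theorem dist_le_dist_add_one (hG : G.Connected) (r : V) {u v : V} (h : G.Adj u v) :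
    G.dist r v ≤ G.dist r u + 1 := by
  have := hG.dist_triangle (u := r) (v := u) (w := v)
  rwa [(SimpleGraph.dist_eq_one_iff_adj).mpr h] at this

/-- A shortest path from `r` to `v`, listed as `f 0, …, f d`. -/
theorem exists_geodesic (hG : G.Connected) (r : V) (d : ℕ) : ∀ v, G.dist r v = d →
    ∃ f : ℕ → V, f d = v ∧ (∀ i ≤ d, G.dist r (f i) = i) ∧ ∀ i < d, G.Adj (f i) (f (i + 1)) := by
  induction d with
  | zero => exact fun v hv => ⟨fun _ => v, rfl, fun i hi => by simp_all, by simp⟩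
  | succ d ih =>
    intro v hv
    obtain ⟨u, huv, hu⟩ := exists_adj_dist_eq hG hv
    obtain ⟨f, hfd, hf, hadj⟩ := ih u hu
    refine ⟨fun i => if i ≤ d then f i else v, by simp, fun i hi => ?_, fun i hi => ?_⟩
    · rcases Nat.lt_or_ge d i with h | h
      · obtain rfl : i = d + 1 := by omega
        simpa using hv
      · simpa [h] using hf i h
    · rcases Nat.lt_or_ge i d with h | h
      · simpa [h.le, Nat.succ_le_of_lt h] using hadj i h
      · obtain rfl : i = d := by omega
        simpa [hfd] using huv

/-- A shortest path is induced, so excluding an induced path bounds all distances. -/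
theorem dist_lt_of_not_path (hG : G.Connected) {n : ℕ}
    (hn : ¬ (pathG n).graph.IsIndContained G) (r v : V) : G.dist r v < n := by
  by_contra hlt
  obtain ⟨f, -, hf, hadj⟩ := exists_geodesic hG r _ v rfl
  have hf' : ∀ i : Fin n, G.dist r (f i) = i := fun i => hf i (by omega)
  refine hn (isIndContained_of_map (H := SimpleGraph.pathGraph n) (fun i => f i)
    (fun i j hij => Fin.ext ?_) fun i j => ?_)
  · rw [← hf' i, ← hf' j]
    exact congrArg _ hij
  · rw [SimpleGraph.pathGraph_adj]
    constructor
    · intro h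
      have h₁ := dist_le_dist_add_one hG r h
      have h₂ := dist_le_dist_add_one hG r h.symm
      have h₃ : (i : ℕ) ≠ j := fun hij => by simp [hij] at h
      rw [hf', hf'] at h₁ h₂
      omega
    · rintro (h | h)
      · exact h ▸ hadj i (by omega)
      · exact h ▸ (hadj j (by omega)).symm

end Layers

/-! ### Descending through the layers -/

/-- For a long family `x` with chosen neighbours `q i` of `x i`, either some `q k` is adjacent to
many members of `x`, or there is a large subfamily on which the `q`–`x` adjacencies form a perfect
matching and the `q`'s form a clique or an independent set. -/
theorem exists_star_or_matching (m : ℕ) : ∃ N : ℕ, ∀ {V : Type} (G : SimpleGraph V)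
    (q x : Fin N → V), (∀ i, G.Adj (q i) (x i)) →
    (∃ k, ∃ f : Fin m → Fin N, StrictMono f ∧ ∀ i, G.Adj (q k) (x (f i))) ∨
    ∃ f : Fin m → Fin N, StrictMono f ∧ (∀ i j, G.Adj (q (f i)) (x (f j)) ↔ i = j) ∧
      ((∀ i j, i ≠ j → G.Adj (q (f i)) (q (f j))) ∨ ∀ i j, ¬ G.Adj (q (f i)) (q (f j))) := by
  obtain ⟨N₁, h₁⟩ := ramsey_adj m
  obtain ⟨N, h⟩ := ramsey_off_diagonal (N₁ + m + 1)
  refine ⟨N, fun G q x hqx => ?_⟩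
  obtain ⟨f, hf, hr | hr | hr⟩ := h fun i j => G.Adj (q i) (x j)
  · refine .inl ⟨f 0, fun i => f (Fin.castLE (by omega) i).succ, fun i j hij => hf ?_,
      fun i => hr _ _ (Fin.succ_pos _)⟩
    exact Fin.succ_lt_succ_iff.mpr hij
  · refine .inl ⟨f (Fin.last _), fun i => f (Fin.castLE (by omega) i).castSucc,
      fun i j hij => hf ?_, fun i => hr _ _ (Fin.castSucc_lt_last _)⟩
    exact hij
  · let e : Fin N₁ → Fin (N₁ + m + 1) := Fin.castLE (by omega)
    have he : StrictMono e := fun i j hij => hij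
    obtain ⟨g, hg, hgq⟩ := h₁ G fun i => q (f (e i))
    have hmono := hf.comp (he.comp hg)
    refine .inr ⟨fun i => f (e (g i)), hmono, fun i j => ⟨fun hadj => ?_, ?_⟩, hgq⟩
    · by_contra hij
      exact hr _ _ ((he.comp hg).injective.ne hij) hadj
    · rintro rfl
      exact hqx _

/-- A large induced matching between two consecutive layers yields `K_{1,n}^*` or `K_n^*`: the
parents of its upper ends give a star, a clique, or an induced matching one layer closer to
the root. -/
theorem starPendant_or_cliquePendant_of_matching (n d : ℕ) : ∃ N : ℕ, ∀ {V : Type}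
    (G : SimpleGraph V) (r : V) (p x : Fin N → V), G.Connected →
    (∀ i, G.dist r (p i) = d) → (∀ i, G.dist r (x i) = d + 1) →
    (∀ i j, ¬ G.Adj (p i) (p j)) → (∀ i j, ¬ G.Adj (x i) (x j)) →
    (∀ i j, G.Adj (p i) (x j) ↔ i = j) →
    (starPendantG n).graph.IsIndContained G ∨ (cliquePendantG n).graph.IsIndContained G := by
  induction d with
  | zero =>
    refine ⟨2, fun G r p x hG hp _ _ _ hpx => ?_⟩
    have h : p 0 = p 1 := by
      rw [← hG.dist_eq_zero_iff.mp (hp 0), hG.dist_eq_zero_iff.mp (hp 1)]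
    exact absurd ((hpx 0 1).mp (h ▸ (hpx 1 1).mpr rfl)) (by decide)
  | succ d ih =>
    obtain ⟨N₁, h₁⟩ := ih
    obtain ⟨N, h⟩ := exists_star_or_matching (n + N₁)
    refine ⟨N, fun G r p x hG hp hx hpp hxx hpx => ?_⟩
    choose q hqp hq using fun i => exists_adj_dist_eq hG (hp i)
    -- A common neighbour `q k` of many `p i` lies two layers before the `x i`, hence misses them.
    rcases h G q p hqp with ⟨k, f, hf, hk⟩ | ⟨f, hf, hm, hc | hi⟩
    · refine .inl (starPendant_isIndContained (q k) (fun i => p (f (Fin.castAdd N₁ i)))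
        (fun i => x (f (Fin.castAdd N₁ i))) (fun _ _ => hpp _ _) (fun _ _ => hxx _ _)
        (fun i j => ?_) (fun _ => hk _) (fun i hadj => ?_) fun i heq => ?_)
      · rw [hpx, hf.injective.eq_iff, Fin.castAdd_inj]
      · have := dist_le_dist_add_one hG r hadj
        rw [hq, hx] at this
        omega
      · have := congrArg (G.dist r) heq
        rw [hq, hx] at this
        omega
    · refine .inr (cliquePendant_isIndContained (fun i => q (f (Fin.castAdd N₁ i)))
        (fun i => p (f (Fin.castAdd N₁ i))) (fun i j hij => hc _ _ ?_) (fun _ _ => hpp _ _)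
        fun i j => ?_)
      · simpa using hij
      · rw [hm, Fin.castAdd_inj]
    · refine h₁ G r (fun i => q (f (Fin.natAdd n i))) (fun i => p (f (Fin.natAdd n i))) hG
        (fun _ => hq _) (fun _ => hp _) (fun _ _ => hi _ _) (fun _ _ => hpp _ _) fun i j => ?_
      rw [hm, Fin.natAdd_inj]

/-- A large independent set inside one layer yields `K_{1,n}` or `K_n^*`. -/
theorem star_or_cliquePendant_of_indep (n d : ℕ) : ∃ N : ℕ, ∀ {V : Type}
    (G : SimpleGraph V) (r : V) (x : Fin N → V), G.Connected → Function.Injective x →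
    (∀ i, G.dist r (x i) = d) → (∀ i j, ¬ G.Adj (x i) (x j)) →
    (starG n).graph.IsIndContained G ∨ (cliquePendantG n).graph.IsIndContained G := by
  induction d with
  | zero =>
    refine ⟨2, fun G r x hG hinj hx _ => ?_⟩
    have h : x 0 = x 1 := by
      rw [← hG.dist_eq_zero_iff.mp (hx 0), hG.dist_eq_zero_iff.mp (hx 1)]
    exact absurd (hinj h) (by decide)
  | succ d ih =>
    obtain ⟨N₁, h₁⟩ := ih
    obtain ⟨N, h⟩ := exists_star_or_matching (n + N₁)
    refine ⟨N, fun G r x hG hinj hx hxx => ?_⟩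
    choose q hqx hq using fun i => exists_adj_dist_eq hG (hx i)
    rcases h G q x hqx with ⟨k, f, hf, hk⟩ | ⟨f, hf, hm, hc | hi⟩
    · exact .inl (star_isIndContained (q k) (fun i => x (f (Fin.castAdd N₁ i)))
        (hinj.comp (hf.injective.comp (Fin.castAdd_injective _ _))) (fun _ _ => hxx _ _)
        fun _ => hk _)
    · refine .inr (cliquePendant_isIndContained (fun i => q (f (Fin.castAdd N₁ i)))
        (fun i => x (f (Fin.castAdd N₁ i))) (fun i j hij => hc _ _ ?_) (fun _ _ => hxx _ _)
        fun i j => ?_)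
      · simpa using hij
      · rw [hm, Fin.castAdd_inj]
    · refine h₁ G r (fun i => q (f (Fin.natAdd n i))) hG (fun i j hij => ?_) (fun _ => hq _)
        fun _ _ => hi _ _
      have hij' : q (f (Fin.natAdd n i)) = q (f (Fin.natAdd n j)) := hij
      exact (Fin.natAdd_inj n).mp ((hm _ _).mp (hij' ▸ (hm _ _).mpr rfl))

/-! ### Bounding the domination number -/

section Domination

variable {V : Type} {G : SimpleGraph V}

theorem mem_closedNbhd {u v : V} : u ∈ closedNbhd G v ↔ u = v ∨ G.Adj v u := Iff.rfl

theorem mem_closedNbhdSet {u : V} {S : Set V} :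
    u ∈ closedNbhdSet G S ↔ ∃ v ∈ S, u = v ∨ G.Adj v u := by
  simp [closedNbhdSet, mem_closedNbhd]

/-- If `C` covers `U` and no `2k` vertices dominate `U`, then `k` independent vertices of `U` can
be matched to vertices of `C` without further adjacencies. In each step a minimal cover
`S ⊆ C` of `U`, a vertex `s ∈ S` and a private neighbour `x` of `s` are taken, and `U` is replaced
by the vertices dominated neither by `s` nor by `x`. -/
theorem exists_matched_pairs [Finite V] (k : ℕ) : ∀ U C : Set V, (∀ u ∈ U, ∃ c ∈ C, G.Adj c u) →
    (∀ T : Set V, T.ncard ≤ 2 * k → ¬ U ⊆ closedNbhdSet G T) →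
    ∃ s x : Fin k → V, (∀ i, s i ∈ C) ∧ (∀ i, x i ∈ U) ∧ (∀ i j, ¬ G.Adj (x i) (x j)) ∧
      ∀ i j, G.Adj (s i) (x j) ↔ i = j := by
  induction k with
  | zero => exact fun U C _ _ => ⟨Fin.elim0, Fin.elim0, by simp⟩
  | succ k ih =>
    intro U C hC hU
    obtain ⟨u, hu⟩ : U.Nonempty := by
      by_contra h
      exact hU ∅ (by simp) (by simp [Set.not_nonempty_iff_eq_empty.mp h])
    obtain ⟨S, hSC, hS⟩ := (Set.toFinite {S : Set V | ∀ u ∈ U, ∃ c ∈ S, G.Adj c u}).exists_le_minimal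
      (show C ∈ _ from hC)
    obtain ⟨s, hs, -⟩ := hS.prop u hu
    obtain ⟨x, hxU, hx⟩ : ∃ x ∈ U, ∀ c ∈ S \ {s}, ¬ G.Adj c x := by
      by_contra! h
      exact (hS.le_of_le (y := S \ {s}) h Set.sdiff_subset hs).2 rfl
    have hsx : G.Adj s x := by
      obtain ⟨c, hc, hcx⟩ := hS.prop x hxU
      by_cases hcs : c = s
      · exact hcs ▸ hcx
      · exact absurd hcx (hx c ⟨hc, hcs⟩)
    obtain ⟨s', x', hs', hx', hxx, hsx'⟩ := ih (U \ closedNbhdSet G {s, x}) (S \ {s})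
      (fun u hu => by
        obtain ⟨c, hc, hcu⟩ := hS.prop u hu.1
        refine ⟨c, ⟨hc, fun hcs => hu.2 ?_⟩, hcu⟩
        exact mem_closedNbhdSet.mpr ⟨s, by simp, .inr ((show c = s from hcs) ▸ hcu)⟩)
      (fun T hT hUT => hU (T ∪ {s, x})
        ((Set.ncard_union_le _ _).trans (by have := Set.ncard_insert_le s {x}; simp at this; omega))
        (fun u hu => by
          by_cases h : u ∈ closedNbhdSet G {s, x}
          · obtain ⟨v, hv, h⟩ := mem_closedNbhdSet.mp h
            exact mem_closedNbhdSet.mpr ⟨v, .inr hv, h⟩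
          · obtain ⟨v, hv, h⟩ := mem_closedNbhdSet.mp (hUT ⟨hu, h⟩)
            exact mem_closedNbhdSet.mpr ⟨v, .inl hv, h⟩))
    have hs'x : ∀ i, ¬ G.Adj (s' i) x := fun i => hx _ (hs' i)
    have hsx'' : ∀ i, ¬ G.Adj s (x' i) := fun i h =>
      (hx' i).2 (mem_closedNbhdSet.mpr ⟨s, by simp, .inr h⟩)
    have hxx' : ∀ i, ¬ G.Adj x (x' i) := fun i h =>
      (hx' i).2 (mem_closedNbhdSet.mpr ⟨x, by simp, .inr h⟩)
    refine ⟨Fin.cons s s', Fin.cons x x', ?_, ?_, ?_, ?_⟩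
    · exact Fin.cases (hSC hs) fun i => hSC (hs' i).1
    · exact Fin.cases hxU fun i => (hx' i).1
    · simp [Fin.forall_fin_succ, hxx', hxx, G.adj_comm _ x]
    · simp [Fin.forall_fin_succ, hsx, hsx'', hs'x, hsx', Fin.succ_ne_zero, (Fin.succ_ne_zero _).symm]

end Domination

/-- Connected graphs without induced `K_{1,n}^*`, `K_n^*` and `P_n` have bounded domination
number. -/
theorem exists_dominating_ncard_le (n : ℕ) : ∃ c : ℕ, ∀ {V : Type} [Finite V] (G : SimpleGraph V),
    G.Connected → ¬ (starPendantG n).graph.IsIndContained G →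
    ¬ (cliquePendantG n).graph.IsIndContained G → ¬ (pathG n).graph.IsIndContained G →
    ∃ D : Set V, IsDominating G D ∧ D.ncard ≤ c := by
  choose N hN using fun d => starPendant_or_cliquePendant_of_matching n d
  choose M hM using fun d => ramsey_adj (n + N d)
  refine ⟨∑ d ∈ Finset.range n, (1 + 2 * M (d - 1)), fun {V} _ G hG h₁ h₂ h₃ => ?_⟩
  obtain ⟨r⟩ := hG.nonempty
  have layer : ∀ d, ∃ T : Set V, T.ncard ≤ 1 + 2 * M (d - 1) ∧
      {v | G.dist r v = d} ⊆ closedNbhdSet G T := by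
    rintro (_ | d)
    · refine ⟨{r}, by simp, fun v hv => mem_closedNbhdSet.mpr ⟨r, rfl, .inl ?_⟩⟩
      exact (hG.dist_eq_zero_iff.mp hv).symm
    by_contra! hT
    obtain ⟨s, x, hs, hx, hxx, hsx⟩ := exists_matched_pairs (G := G) (M d)
      {v | G.dist r v = d + 1} {v | G.dist r v = d}
      (fun u hu => (exists_adj_dist_eq hG hu).imp fun c hc => hc.symm)
      (fun T hTc => hT T (by simp; omega))
    -- The partners `s` form a clique, giving `K_n^*`, or an independent set, giving an induced
    -- matching between two consecutive layers.
    obtain ⟨f, hf, hc | hi⟩ := hM d G s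
    · refine h₂ (cliquePendant_isIndContained (fun i => s (f (Fin.castAdd _ i)))
        (fun i => x (f (Fin.castAdd _ i))) (fun i j hij => hc _ _ ?_) (fun _ _ => hxx _ _)
        fun i j => ?_)
      · simpa using hij
      · rw [hsx, hf.injective.eq_iff, Fin.castAdd_inj]
    · refine (hN d G r (fun i => s (f (Fin.natAdd _ i))) (fun i => x (f (Fin.natAdd _ i))) hG
        (fun _ => hs _) (fun _ => hx _) (fun _ _ => hi _ _) (fun _ _ => hxx _ _)
        fun i j => ?_).elim h₁ h₂
      rw [hsx, hf.injective.eq_iff, Fin.natAdd_inj]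
  choose T hTc hT using layer
  -- There are only `n` layers, so the union of the sets `T d` has bounded size.
  refine ⟨⋃ d ∈ Finset.range n, T d, Set.eq_univ_of_forall fun v => ?_, ?_⟩
  · obtain ⟨t, ht, h⟩ := mem_closedNbhdSet.mp (hT _ (show v ∈ {u | G.dist r u = G.dist r v} from rfl))
    refine mem_closedNbhdSet.mpr ⟨t, Set.mem_biUnion (x := G.dist r v) ?_ ht, h⟩
    simpa using dist_lt_of_not_path hG h₃ r v
  · exact (Finset.set_ncard_biUnion_le _ _).trans (Finset.sum_le_sum fun d _ => hTc d)

/-! ### Relations between the parameters -/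

section Chain

variable {V : Type} {G : SimpleGraph V}

theorem isDominating_iff {S : Set V} :
    IsDominating G S ↔ ∀ u, ∃ v ∈ S, u = v ∨ G.Adj v u := by
  simp [IsDominating, Set.eq_univ_iff_forall, mem_closedNbhdSet]

theorem isIrredundant_iff {S : Set V} : IsIrredundant G S ↔
    ∀ s ∈ S, ∃ t, (t = s ∨ G.Adj s t) ∧ ∀ v ∈ S, v ≠ s → t ≠ v ∧ ¬ G.Adj v t := by
  refine forall₂_congr fun s _ => exists_congr fun t => and_congr Iff.rfl ?_
  simp [mem_closedNbhdSet]

theorem isIrredundant_of_minimal_isDominating {S : Set V} (hS : Minimal (IsDominating G) S) :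
    IsIrredundant G S := by
  rw [isIrredundant_iff]
  intro s hs
  by_contra! h
  refine (hS.le_of_le (y := S \ {s}) (isDominating_iff.mpr fun u => ?_) Set.sdiff_subset hs).2 rfl
  obtain ⟨v, hv, huv⟩ := isDominating_iff.mp hS.prop u
  by_cases hvs : v = s
  · obtain ⟨w, hw, hws, h⟩ := h u (hvs ▸ huv)
    exact ⟨w, ⟨hw, hws⟩, or_iff_not_imp_left.mpr h⟩
  · exact ⟨v, ⟨hv, hvs⟩, huv⟩

/-- A vertex of `T` outside a dominating set `S ⊆ T` would have no private neighbour. -/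
theorem subset_of_isDominating_of_isIrredundant {S T : Set V} (hS : IsDominating G S)
    (hT : IsIrredundant G T) (h : S ⊆ T) : T ⊆ S := by
  intro t ht
  by_contra hts
  obtain ⟨u, -, hu⟩ := isIrredundant_iff.mp hT t ht
  obtain ⟨v, hv, huv⟩ := isDominating_iff.mp hS u
  have := hu v (h hv) fun hvt => hts (hvt ▸ hv)
  exact huv.elim this.1 this.2

theorem maximal_isIrredundant_of_minimal_isDominating {S : Set V}
    (hS : Minimal (IsDominating G) S) : Maximal (IsIrredundant G) S :=
  ⟨isIrredundant_of_minimal_isDominating hS,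
    fun _ hT h => subset_of_isDominating_of_isIrredundant hS.prop hT h⟩

theorem minimal_isDominating_of_isIrredundant {S : Set V} (hS : IsDominating G S)
    (hS' : IsIrredundant G S) : Minimal (IsDominating G) S :=
  ⟨hS, fun _ hT h => subset_of_isDominating_of_isIrredundant hT hS' h⟩

/-- A maximal irredundant set together with one private neighbour of each of its vertices
dominates: a vertex dominated by none of these could be added to the set. -/
theorem exists_dominating_of_maximal_isIrredundant [Finite V] {S : Set V}
    (hS : Maximal (IsIrredundant G) S) : ∃ D, IsDominating G D ∧ D.ncard ≤ 2 * S.ncard := by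
  choose! p hp hp' using isIrredundant_iff.mp hS.prop
  refine ⟨S ∪ p '' S, isDominating_iff.mpr fun u => ?_, ?_⟩
  · by_contra! h
    have hu : ∀ v ∈ S, u ≠ v ∧ ¬ G.Adj v u := fun v hv => h v (.inl hv)
    have hpu : ∀ v ∈ S, u ≠ p v ∧ ¬ G.Adj (p v) u := fun v hv => h _ (.inr ⟨v, hv, rfl⟩)
    have hirr : IsIrredundant G (insert u S) := by
      rw [isIrredundant_iff]
      rintro s (rfl | hs)
      · exact ⟨s, .inl rfl, fun v hv hvs => hu v (hv.resolve_left hvs)⟩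
      · refine ⟨p s, hp s hs, ?_⟩
        rintro v (rfl | hv) hvs
        · exact ⟨(hpu s hs).1.symm, fun hadj => (hpu s hs).2 hadj.symm⟩
        · exact hp' s hs v hv hvs
    exact (hu u (hS.le_of_ge hirr (Set.subset_insert _ _) (Set.mem_insert _ _))).1 rfl
  · have h₁ := Set.ncard_union_le S (p '' S)
    have h₂ := Set.ncard_image_le (f := p) S.toFinite
    omega

theorem exists_adj_of_maximal_isIndepSet {S : Set V} (hS : Maximal G.IsIndepSet S) {u : V}
    (hu : u ∉ S) : ∃ v ∈ S, G.Adj v u := by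
  by_contra! h
  refine hu (hS.le_of_ge (y := insert u S) ?_ (Set.subset_insert _ _) (Set.mem_insert _ _))
  exact hS.prop.insert fun v hv _ => ⟨fun hadj => h v hv hadj.symm, h v hv⟩

theorem isDominating_of_maximal_isIndepSet {S : Set V} (hS : Maximal G.IsIndepSet S) :
    IsDominating G S := by
  refine isDominating_iff.mpr fun u => ?_
  by_cases hu : u ∈ S
  · exact ⟨u, hu, .inl rfl⟩
  · exact (exists_adj_of_maximal_isIndepSet hS hu).imp fun v hv => ⟨hv.1, .inr hv.2⟩

theorem exists_minimal_isDominating [Finite V] {D : Set V} (hD : IsDominating G D) :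
    ∃ S ⊆ D, Minimal (IsDominating G) S :=
  (Set.toFinite {S | IsDominating G S}).exists_le_minimal hD

theorem exists_maximal_isIrredundant [Finite V] {S : Set V} (hS : IsIrredundant G S) :
    ∃ T, S ⊆ T ∧ Maximal (IsIrredundant G) T :=
  (Set.toFinite {S | IsIrredundant G S}).exists_le_maximal hS

theorem exists_maximal_isIndepSet [Finite V] {S : Set V} (hS : G.IsIndepSet S) :
    ∃ T, S ⊆ T ∧ Maximal G.IsIndepSet T :=
  (Set.toFinite {S | G.IsIndepSet S}).exists_le_maximal hS

end Chain

theorem bddAbove_ncard {V : Type} [Finite V] (P : Set V → Prop) :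
    BddAbove {k | ∃ S : Set V, P S ∧ S.ncard = k} := by
  refine ⟨Nat.card V, ?_⟩
  rintro _ ⟨S, -, rfl⟩
  exact Set.ncard_le_card S

theorem ir_le_of_isDominating {G : FinGraph} {D : Set G.V} (hD : IsDominating G.graph D) :
    ir G ≤ D.ncard := by
  have := G.finite
  obtain ⟨S, hSD, hS⟩ := exists_minimal_isDominating hD
  have h : ir G ≤ S.ncard :=
    Nat.sInf_le ⟨S, maximal_isIrredundant_of_minimal_isDominating hS, rfl⟩
  exact h.trans (Set.ncard_le_ncard hSD)

theorem exists_dominating_ncard_le_two_mul_ir (G : FinGraph) :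
    ∃ D, IsDominating G.graph D ∧ D.ncard ≤ 2 * ir G := by
  have := G.finite
  obtain ⟨T, -, hT⟩ := exists_maximal_isIrredundant (G := G.graph) (S := ∅)
    (isIrredundant_iff.mpr (by simp))
  obtain ⟨S, hS, hSc⟩ := Nat.sInf_mem
    (s := {k | ∃ S : Set G.V, Maximal (IsIrredundant G.graph) S ∧ S.ncard = k}) ⟨_, T, hT, rfl⟩
  rw [ir, ← hSc]
  exact exists_dominating_of_maximal_isIrredundant hS

theorem exists_maximal_isIndepSet_ncard_eq (G : FinGraph) :
    ∃ S, Maximal G.graph.IsIndepSet S ∧ S.ncard = indepDom G := by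
  have := G.finite
  obtain ⟨T, -, hT⟩ := exists_maximal_isIndepSet (G := G.graph) (S := ∅) (by simp)
  exact Nat.sInf_mem (s := {k | ∃ S : Set G.V, Maximal G.graph.IsIndepSet S ∧ S.ncard = k})
    ⟨_, T, hT, rfl⟩

theorem le_upperDom {G : FinGraph} {S : Set G.V} (hS : Minimal (IsDominating G.graph) S) :
    S.ncard ≤ upperDom G :=
  have := G.finite
  le_csSup (bddAbove_ncard _) ⟨S, hS, rfl⟩

theorem upperDom_le_upperIR (G : FinGraph) : upperDom G ≤ upperIR G := by
  have := G.finite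
  refine csSup_le' ?_
  rintro _ ⟨S, hS, rfl⟩
  exact le_csSup (bddAbove_ncard _) ⟨S, maximal_isIrredundant_of_minimal_isDominating hS, rfl⟩

/-! ### Lower bounds on the parameters of the special graphs -/

section LowerBounds

variable {V : Type} {G : SimpleGraph V} {n : ℕ}

theorem le_ncard_of_injective [Finite V] {S : Set V} (g : Fin n → V)
    (hg : Function.Injective g) (h : ∀ i, g i ∈ S) : n ≤ S.ncard := by
  rw [← Nat.card_fin n, ← Set.ncard_range_of_injective hg]
  exact Set.ncard_le_ncard (Set.range_subset_iff.mpr h)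

/-- Vertices with pairwise disjoint closed neighbourhoods bound the size of every dominating set
from below. -/
theorem le_ncard_of_packing [Finite V] (t : Fin n → V)
    (ht : ∀ i j u, (t i = u ∨ G.Adj u (t i)) → (t j = u ∨ G.Adj u (t j)) → i = j)
    {D : Set V} (hD : IsDominating G D) : n ≤ D.ncard := by
  choose f hf hft using fun i => isDominating_iff.mp hD (t i)
  have hinj : Function.Injective f := fun i j hij => ht i j (f i) (hft i) (hij ▸ hft j)
  exact le_ncard_of_injective f hinj hf

theorem le_two_mul_ir_of_packing [Finite V] (t : Fin n → V)
    (ht : ∀ i j u, (t i = u ∨ G.Adj u (t i)) → (t j = u ∨ G.Adj u (t j)) → i = j) :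
    n ≤ 2 * ir (.of G) := by
  obtain ⟨D, hD, hDc⟩ := exists_dominating_ncard_le_two_mul_ir (.of G)
  exact (le_ncard_of_packing t ht hD).trans hDc

theorem le_indepDom_of_packing [Finite V] (t : Fin n → V)
    (ht : ∀ i j u, (t i = u ∨ G.Adj u (t i)) → (t j = u ∨ G.Adj u (t j)) → i = j) :
    n ≤ indepDom (.of G) := by
  obtain ⟨S, hS, hSc⟩ := exists_maximal_isIndepSet_ncard_eq (.of G)
  rw [← hSc]
  exact le_ncard_of_packing t ht (isDominating_of_maximal_isIndepSet hS)

theorem le_upperDom_of_packing [Finite V] (t : Fin n → V)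
    (ht : ∀ i j u, (t i = u ∨ G.Adj u (t i)) → (t j = u ∨ G.Adj u (t j)) → i = j) :
    n ≤ upperDom (.of G) := by
  obtain ⟨S, -, hS⟩ := exists_minimal_isDominating (G := G) (D := Set.univ)
    (isDominating_iff.mpr fun u => ⟨u, trivial, .inl rfl⟩)
  exact (le_ncard_of_packing t ht hS.prop).trans (le_upperDom (G := .of G) hS)

/-- A dominating family `s` with private neighbours `t` is a minimal dominating set. -/
theorem le_upperDom_of_private [Finite V] (s t : Fin n → V)
    (hs : ∀ u, ∃ i, u = s i ∨ G.Adj (s i) u)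
    (ht : ∀ i j, (t i = s j ∨ G.Adj (s j) (t i)) ↔ i = j) : n ≤ upperDom (.of G) := by
  have hinj : Function.Injective s := fun i j hij => (ht i j).mp (hij ▸ (ht i i).mpr rfl)
  have hmin : Minimal (IsDominating G) (Set.range s) := by
    refine minimal_isDominating_of_isIrredundant (isDominating_iff.mpr fun u => ?_)
      (isIrredundant_iff.mpr ?_)
    · obtain ⟨i, hi⟩ := hs u
      exact ⟨s i, ⟨i, rfl⟩, hi⟩
    · rintro _ ⟨i, rfl⟩
      refine ⟨t i, (ht i i).mpr rfl, ?_⟩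
      rintro _ ⟨j, rfl⟩ hji
      exact ⟨fun h => hji (congrArg s ((ht i j).mp (.inl h)).symm),
        fun h => hji (congrArg s ((ht i j).mp (.inr h)).symm)⟩
  exact (le_ncard_of_injective s hinj Set.mem_range_self).trans (le_upperDom (G := .of G) hmin)

theorem addPendants_packing {W : Type} {H : SimpleGraph W} {f : Fin n → W}
    (hf : Function.Injective f) (i j : Fin n) (u : W ⊕ Fin n)
    (hi : .inr i = u ∨ (addPendants H f).Adj u (.inr i))
    (hj : .inr j = u ∨ (addPendants H f).Adj u (.inr j)) : i = j := by
  rcases u with u | k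
  · have hi' : u = f i := hi.resolve_left (by simp)
    have hj' : u = f j := hj.resolve_left (by simp)
    exact hf (hi'.symm.trans hj')
  · exact (Sum.inr_injective (hi.resolve_right id)).trans
      (Sum.inr_injective (hj.resolve_right id)).symm

/-- Every third vertex of a path. -/
def pathPacking (n : ℕ) (i : Fin n) : Fin (3 * n) := ⟨3 * i, by omega⟩

theorem path_packing (i j : Fin n) (u : Fin (3 * n))
    (hi : pathPacking n i = u ∨ (SimpleGraph.pathGraph (3 * n)).Adj u (pathPacking n i))
    (hj : pathPacking n j = u ∨ (SimpleGraph.pathGraph (3 * n)).Adj u (pathPacking n j)) :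
    i = j := by
  simp only [SimpleGraph.pathGraph_adj, pathPacking, Fin.ext_iff] at *
  omega

theorem le_indepDom_biclique (n : ℕ) : n ≤ indepDom (bicliqueG n) := by
  obtain ⟨S, hS, hSc⟩ := exists_maximal_isIndepSet_ncard_eq (bicliqueG n)
  rw [← hSc]
  change Set (Fin n ⊕ Fin n) at S
  change Maximal (completeBipartiteGraph (Fin n) (Fin n)).IsIndepSet S at hS
  by_cases h : ∃ j, (.inr j : Fin n ⊕ Fin n) ∈ S
  · obtain ⟨j, hj⟩ := h
    refine le_ncard_of_injective (V := Fin n ⊕ Fin n) .inr Sum.inr_injective fun i => ?_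
    by_contra hi
    obtain ⟨k | k, hk, hadj⟩ := exists_adj_of_maximal_isIndepSet hS hi
    · exact hS.prop hk hj (by simp) (by simp)
    · simp at hadj
  · refine le_ncard_of_injective (V := Fin n ⊕ Fin n) .inl Sum.inl_injective fun i => ?_
    by_contra hi
    obtain ⟨k | k, hk, hadj⟩ := exists_adj_of_maximal_isIndepSet hS hi
    · simp at hadj
    · exact h ⟨k, hk⟩

/-- A maximal independent set misses one of the two centres, so it contains all leaves there. -/
theorem le_indepDom_bistar (n : ℕ) : n ≤ indepDom (bistarG n) := by
  obtain ⟨S, hS, hSc⟩ := exists_maximal_isIndepSet_ncard_eq (bistarG n)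
  rw [← hSc]
  change Set (Fin 2 ⊕ (Fin 2 × Fin n)) at S
  change Maximal (addPendants (SimpleGraph.completeGraph (Fin 2))
    (Prod.fst : Fin 2 × Fin n → Fin 2)).IsIndepSet S at hS
  obtain ⟨a, ha⟩ : ∃ a : Fin 2, .inl a ∉ S := by
    by_contra! h
    exact hS.prop (h 0) (h 1) (by simp) (show (0 : Fin 2) ≠ 1 by decide)
  let g : Fin n → Fin 2 ⊕ (Fin 2 × Fin n) := fun i => .inr (a, i)
  have hg : Function.Injective g := fun i j hij => by simpa [g] using hij
  refine le_ncard_of_injective (V := Fin 2 ⊕ (Fin 2 × Fin n)) g hg fun i => ?_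
  by_contra hi
  obtain ⟨k | k, hk, hadj⟩ := exists_adj_of_maximal_isIndepSet hS hi
  · exact ha ((show k = a from hadj) ▸ hk)
  · exact hadj

theorem le_upperDom_star (hn : 0 < n) : n ≤ upperDom (starG n) := by
  refine le_upperDom_of_private (G := completeBipartiteGraph (Fin 1) (Fin n))
    Sum.inr Sum.inr ?_ ?_
  · rintro (i | i)
    · exact ⟨⟨0, hn⟩, by simp⟩
    · exact ⟨i, .inl rfl⟩
  · simp

theorem le_upperDom_matchedCliques (n : ℕ) : n ≤ upperDom (matchedCliquesG n) := by
  refine le_upperDom_of_private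
    (G := SimpleGraph.fromRel fun x y : Fin 2 × Fin n => x.1 = y.1 ∨ x.2 = y.2)
    (fun i => (0, i)) (fun i => (1, i)) ?_ ?_
  · rintro ⟨a, i⟩
    refine ⟨i, ?_⟩
    fin_cases a <;> simp
  · simp [eq_comm]

end LowerBounds

/-! ### Connectedness of the special graphs -/

theorem addPendants_connected {V ι : Type} {G : SimpleGraph V} (hG : G.Connected) (f : ι → V) :
    (addPendants G f).Connected := by
  obtain ⟨r⟩ := hG.nonempty
  let φ : G →g addPendants G f := ⟨Sum.inl, fun h => h⟩
  refine SimpleGraph.connected_iff_exists_forall_reachable _ |>.mpr ⟨.inl r, ?_⟩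
  rintro (v | i)
  · exact (hG r v).map φ
  · exact ((hG r (f i)).map φ).trans
      (SimpleGraph.Adj.reachable (show (addPendants G f).Adj (.inl (f i)) (.inr i) from rfl))

theorem completeBipartiteGraph_connected {V W : Type} [Nonempty V] [Nonempty W] :
    (completeBipartiteGraph V W).Connected := by
  obtain ⟨v⟩ := ‹Nonempty V›
  obtain ⟨w⟩ := ‹Nonempty W›
  have h : ∀ a b, (completeBipartiteGraph V W).Reachable (.inl a) (.inr b) := fun a b =>
    SimpleGraph.Adj.reachable (by simp)
  refine SimpleGraph.connected_iff_exists_forall_reachable _ |>.mpr ⟨.inl v, ?_⟩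
  rintro (a | b)
  exacts [(h v w).trans (h a w).symm, h v b]

theorem matchedCliques_connected {n : ℕ} (hn : 0 < n) : (matchedCliquesG n).graph.Connected := by
  change (SimpleGraph.fromRel fun x y : Fin 2 × Fin n => x.1 = y.1 ∨ x.2 = y.2).Connected
  set H := SimpleGraph.fromRel fun x y : Fin 2 × Fin n => x.1 = y.1 ∨ x.2 = y.2 with hH
  have key : ∀ x y : Fin 2 × Fin n, x.1 = y.1 ∨ x.2 = y.2 → H.Reachable x y := by
    intro x y h
    by_cases hxy : x = y
    · exact hxy ▸ .rfl
    · exact SimpleGraph.Adj.reachable ((SimpleGraph.fromRel_adj _ _ _).mpr ⟨hxy, .inl h⟩)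
  refine SimpleGraph.connected_iff_exists_forall_reachable _ |>.mpr ⟨(0, ⟨0, hn⟩), fun y => ?_⟩
  exact (key (0, ⟨0, hn⟩) (0, y.2) (.inl rfl)).trans (key _ y (.inr rfl))

section SpecialConnected

variable {n : ℕ}

theorem path_connected (hn : 0 < n) : (pathG n).graph.Connected := by
  obtain ⟨m, rfl⟩ := Nat.exists_eq_succ_of_ne_zero hn.ne'
  exact SimpleGraph.pathGraph_connected m

theorem cliquePendant_connected (hn : 0 < n) : (cliquePendantG n).graph.Connected :=
  have : Nonempty (Fin n) := ⟨⟨0, hn⟩⟩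
  addPendants_connected SimpleGraph.connected_top _

theorem starPendant_connected (hn : 0 < n) : (starPendantG n).graph.Connected :=
  have : Nonempty (Fin n) := ⟨⟨0, hn⟩⟩
  addPendants_connected completeBipartiteGraph_connected _

theorem star_connected (hn : 0 < n) : (starG n).graph.Connected :=
  have : Nonempty (Fin n) := ⟨⟨0, hn⟩⟩
  completeBipartiteGraph_connected

theorem biclique_connected (hn : 0 < n) : (bicliqueG n).graph.Connected :=
  have : Nonempty (Fin n) := ⟨⟨0, hn⟩⟩
  completeBipartiteGraph_connected

theorem bistar_connected : (bistarG n).graph.Connected :=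
  addPendants_connected SimpleGraph.connected_top _

end SpecialConnected

/-! ### Bounding the independent domination number -/

theorem exists_family_of_le_ncard {V : Type} {S : Set V} {m : ℕ} (h : m ≤ S.ncard) :
    ∃ x : Fin m → V, Function.Injective x ∧ ∀ i, x i ∈ S := by
  obtain ⟨T, hTS, hT⟩ := Set.exists_subset_card_eq h
  rcases Nat.eq_zero_or_pos m with rfl | hm
  · exact ⟨Fin.elim0, fun i => i.elim0, fun i => i.elim0⟩
  have : Finite T := (Set.finite_of_ncard_pos (by omega)).to_subtype
  let e : T ≃ Fin m := Finite.equivFinOfCardEq (by rwa [Nat.card_coe_set_eq])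
  exact ⟨fun i => e.symm i, Subtype.val_injective.comp e.symm.injective,
    fun i => hTS (e.symm i).2⟩

theorem isIndepSet_family {V : Type} {G : SimpleGraph V} {S : Set V} (hS : G.IsIndepSet S)
    {m : ℕ} {x : Fin m → V} (hx : ∀ i, x i ∈ S) (i j : Fin m) : ¬ G.Adj (x i) (x j) :=
  fun h => hS (hx i) (hx j) h.ne h

/-- Between two long independent families there is a large induced biclique, or else the families
have long subfamilies whose only mutual adjacencies join members of equal index. -/
theorem biclique_or_off_diagonal (n : ℕ) : ∃ M : ℕ, ∀ {V : Type} (G : SimpleGraph V)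
    (y z : Fin M → V), Function.Injective y → Function.Injective z →
    (∀ i j, ¬ G.Adj (y i) (y j)) → (∀ i j, ¬ G.Adj (z i) (z j)) →
    (bicliqueG n).graph.IsIndContained G ∨
      ∃ f : Fin (n + n) → Fin M, StrictMono f ∧ ∀ i j, i ≠ j → ¬ G.Adj (y (f i)) (z (f j)) := by
  obtain ⟨M, hM⟩ := ramsey_off_diagonal (n + n)
  refine ⟨M, fun G y z hy hz hyy hzz => ?_⟩
  have hlt : ∀ i j : Fin n, Fin.castAdd n i < Fin.natAdd n j := fun i j => by
    simp only [Fin.lt_def, Fin.val_castAdd, Fin.val_natAdd]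
    omega
  -- If the adjacencies fill one side of the diagonal, then one half of one family is completely
  -- joined to the other half of the other family.
  obtain ⟨f, hf, h | h | h⟩ := hM fun i j => G.Adj (y i) (z j)
  · exact .inl (biclique_isIndContained (fun i => y (f (Fin.castAdd n i)))
      (fun i => z (f (Fin.natAdd n i)))
      (hy.comp (hf.injective.comp (Fin.castAdd_injective n n)))
      (hz.comp (hf.injective.comp (Fin.natAdd_injective n n)))
      (fun _ _ => hyy _ _) (fun _ _ => hzz _ _) fun i j => h _ _ (hlt i j))
  · exact .inl (biclique_isIndContained (fun i => y (f (Fin.natAdd n i)))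
      (fun i => z (f (Fin.castAdd n i)))
      (hy.comp (hf.injective.comp (Fin.natAdd_injective n n)))
      (hz.comp (hf.injective.comp (Fin.castAdd_injective n n)))
      (fun _ _ => hyy _ _) (fun _ _ => hzz _ _) fun i j => h _ _ (hlt j i))
  · exact .inr ⟨f, hf, h⟩

/-- Large independent sets of neighbours of only `u` and of only `w`, for adjacent `u` and `w`,
give a biclique or a bistar. -/
theorem biclique_or_bistar (n : ℕ) : ∃ M : ℕ, ∀ {V : Type} (G : SimpleGraph V) (u w : V)
    (Y Z : Set V), G.Adj u w → G.IsIndepSet Y → G.IsIndepSet Z →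
    Y ⊆ G.neighborSet u \ G.neighborSet w → Z ⊆ G.neighborSet w \ G.neighborSet u →
    M ≤ Y.ncard → M ≤ Z.ncard →
    (bicliqueG n).graph.IsIndContained G ∨ (bistarG n).graph.IsIndContained G := by
  obtain ⟨M, hM⟩ := biclique_or_off_diagonal n
  refine ⟨M, fun G u w Y Z huw hYi hZi hY hZ hYc hZc => ?_⟩
  obtain ⟨y, hy, hyY⟩ := exists_family_of_le_ncard hYc
  obtain ⟨z, hz, hzZ⟩ := exists_family_of_le_ncard hZc
  have hyy := isIndepSet_family hYi hyY
  have hzz := isIndepSet_family hZi hzZ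
  refine (hM G y z hy hz hyy hzz).imp_right ?_
  rintro ⟨f, hf, h⟩
  refine bistar_isIndContained u w (fun i => y (f (Fin.castAdd n i)))
    (fun i => z (f (Fin.natAdd n i))) huw
    (hy.comp (hf.injective.comp (Fin.castAdd_injective n n)))
    (hz.comp (hf.injective.comp (Fin.natAdd_injective n n)))
    (fun i => (hY (hyY _)).1) (fun i => (hZ (hzZ _)).1) (fun i => (hZ (hzZ _)).2)
    (fun i => (hY (hyY _)).2) (fun _ _ => hyy _ _) (fun _ _ => hzz _ _) fun i j => h _ _ ?_
  simp only [ne_eq, Fin.ext_iff, Fin.val_castAdd, Fin.val_natAdd]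
  omega

/-- A large matching between two independent sets, one adjacent to `v` and the other not, gives a
biclique or an induced matching, which extends to `K_{1,n}^*` with centre `v`. -/
theorem biclique_or_starPendant (n : ℕ) : ∃ M : ℕ, ∀ {V : Type} (G : SimpleGraph V) (v : V)
    (y z : Fin M → V), Function.Injective y → Function.Injective z →
    (∀ i j, ¬ G.Adj (y i) (y j)) → (∀ i j, ¬ G.Adj (z i) (z j)) → (∀ i, G.Adj (y i) (z i)) →
    (∀ i, G.Adj v (y i)) → (∀ i, ¬ G.Adj v (z i)) → (∀ i, v ≠ z i) →
    (bicliqueG n).graph.IsIndContained G ∨ (starPendantG n).graph.IsIndContained G := by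
  obtain ⟨M, hM⟩ := biclique_or_off_diagonal n
  refine ⟨M, fun G v y z hy hz hyy hzz hyz hvy hvz hvz' => ?_⟩
  refine (hM G y z hy hz hyy hzz).imp_right ?_
  rintro ⟨f, hf, h⟩
  refine starPendant_isIndContained v (fun i => y (f (Fin.castAdd n i)))
    (fun i => z (f (Fin.castAdd n i))) (fun _ _ => hyy _ _) (fun _ _ => hzz _ _)
    (fun i j => ⟨fun hadj => ?_, ?_⟩) (fun _ => hvy _) (fun _ => hvz _) fun _ => hvz' _
  · by_contra hij
    exact h _ _ (by simpa using hij) hadj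
  · rintro rfl
    exact hyz _

section

variable {V : Type} {G : SimpleGraph V}

/-- Two disjoint independent sets span a matching of size `k` or contain in their union an
independent set missing at most `2k` vertices: remove the ends of a maximal matching. -/
theorem exists_matching_or_indep [Finite V] (k : ℕ) : ∀ A B : Set V, Disjoint A B →
    G.IsIndepSet A → G.IsIndepSet B →
    (∃ a b : Fin k → V, Function.Injective a ∧ Function.Injective b ∧ (∀ i, a i ∈ A) ∧
      (∀ i, b i ∈ B) ∧ ∀ i, G.Adj (a i) (b i)) ∨
    ∃ T ⊆ A ∪ B, G.IsIndepSet T ∧ A.ncard + B.ncard ≤ T.ncard + 2 * k := by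
  induction k with
  | zero =>
    exact fun A B _ _ _ => .inl ⟨Fin.elim0, Fin.elim0, fun i => i.elim0, fun i => i.elim0,
      fun i => i.elim0, fun i => i.elim0, fun i => i.elim0⟩
  | succ k ih =>
    intro A B hAB hA hB
    by_cases hedge : ∃ a ∈ A, ∃ b ∈ B, G.Adj a b
    · obtain ⟨a, ha, b, hb, hab⟩ := hedge
      rcases ih (A \ {a}) (B \ {b}) (hAB.mono Set.sdiff_subset Set.sdiff_subset)
        (hA.mono Set.sdiff_subset) (hB.mono Set.sdiff_subset) with
        ⟨a', b', hia, hib, ha', hb', h⟩ | ⟨T, hT, hTi, hTc⟩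
      · refine .inl ⟨Fin.cons a a', Fin.cons b b', ?_, ?_, ?_, ?_, ?_⟩
        · refine Fin.cons_injective_iff.mpr ⟨?_, hia⟩
          rintro ⟨i, hi⟩
          exact (ha' i).2 hi
        · refine Fin.cons_injective_iff.mpr ⟨?_, hib⟩
          rintro ⟨i, hi⟩
          exact (hb' i).2 hi
        · exact Fin.cases ha fun i => (ha' i).1
        · exact Fin.cases hb fun i => (hb' i).1
        · exact Fin.cases hab h
      · refine .inr ⟨T, hT.trans (Set.union_subset_union Set.sdiff_subset Set.sdiff_subset),
          hTi, ?_⟩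
        have h₁ := Set.ncard_sdiff_singleton_add_one ha
        have h₂ := Set.ncard_sdiff_singleton_add_one hb
        omega
    · push Not at hedge
      refine .inr ⟨A ∪ B, subset_rfl, ?_, ?_⟩
      · rintro u (hu | hu) v (hv | hv) huv
        · exact hA hu hv huv
        · exact hedge u hu v hv
        · exact fun h => hedge v hv u hu h.symm
        · exact hB hu hv huv
      · rw [Set.ncard_union_eq hAB]
        omega

end

/-- Let `v`, `w` be adjacent, and suppose that `N(v)` contains an independent set `C` at least as
large as every independent set of `N(w)`. In the absence of the three special graphs, the vertices
adjacent to `w` only cannot contain a large independent set `E`. For if most of `C` lies outside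
`N(w)`, then `C` and `E` give a bistar or a biclique; otherwise `C ∩ N(w)` and `E` must span a
large matching, since `N(w)` would contain an independent set larger than `C`. -/
theorem exists_indep_private_bound (n : ℕ) : ∃ M : ℕ, ∀ {V : Type} [Finite V]
    (G : SimpleGraph V) (v w : V) (C E : Set V),
    ¬ (starPendantG n).graph.IsIndContained G → ¬ (bicliqueG n).graph.IsIndContained G →
    ¬ (bistarG n).graph.IsIndContained G → G.Adj v w →
    C ⊆ G.neighborSet v → G.IsIndepSet C →
    (∀ T ⊆ G.neighborSet w, G.IsIndepSet T → T.ncard ≤ C.ncard) →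
    E ⊆ G.neighborSet w \ G.neighborSet v → v ∉ E → G.IsIndepSet E → E.ncard < M := by
  obtain ⟨M₁, h₁⟩ := biclique_or_bistar n
  obtain ⟨M₂, h₂⟩ := biclique_or_starPendant n
  refine ⟨M₁ + 2 * M₂, fun G v w C E hsp hbc hbs hvw hCv hC hmax hEw hvE hE => ?_⟩
  by_contra! hEc
  have hCw : (C \ G.neighborSet w).ncard < M₁ := by
    by_contra! hc
    refine (h₁ G v w _ E hvw (hC.mono Set.sdiff_subset) hE (Set.sdiff_subset_sdiff_left hCv) hEw
      hc (by omega)).elim hbc hbs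
  have hcard := Set.ncard_inter_add_ncard_sdiff_eq_ncard C (G.neighborSet w)
  have hdisj : Disjoint (C ∩ G.neighborSet w) E :=
    Set.disjoint_left.mpr fun u hu huE => (hEw huE).2 (hCv hu.1)
  have hC' : G.IsIndepSet (C ∩ G.neighborSet w) := hC.mono Set.inter_subset_left
  rcases exists_matching_or_indep M₂ _ E hdisj hC' hE with
    ⟨a, b, hia, hib, ha, hb, hab⟩ | ⟨T, hT, hTi, hTc⟩
  · exact (h₂ G v a b hia hib (isIndepSet_family hC' ha) (isIndepSet_family hE hb) hab
      (fun i => hCv (ha i).1) (fun i => (hEw (hb i)).2)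
      fun i h => hvE (h ▸ hb i)).elim hbc hsp
  · have := hmax T (hT.trans (Set.union_subset Set.inter_subset_right fun u hu => (hEw hu).1)) hTi
    omega

/-- Picking vertices greedily by decreasing `f` gives an independent subset `D₀` of `D` such that
every other vertex of `D` has a neighbour in `D₀` with at least the same value of `f`. -/
theorem exists_greedy_indep {V : Type} (G : SimpleGraph V) (f : V → ℕ) (D : Finset V) :
    ∃ D₀ ⊆ D, G.IsIndepSet D₀ ∧ ∀ w ∈ D, w ∈ D₀ ∨ ∃ v ∈ D₀, G.Adj v w ∧ f w ≤ f v := by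
  classical
  induction D using Finset.strongInduction with
  | H D ih =>
    rcases D.eq_empty_or_nonempty with rfl | hne
    · exact ⟨∅, by simp⟩
    obtain ⟨v, hv, hmax⟩ := D.exists_max_image f hne
    obtain ⟨D₁, hD₁, hi, h⟩ := ih (D.filter fun u => u ≠ v ∧ ¬ G.Adj v u)
      (Finset.filter_ssubset.mpr ⟨v, hv, by simp⟩)
    -- The vertices of `D` adjacent to `v` are taken care of by the maximality of `f v`.
    refine ⟨insert v D₁, Finset.insert_subset hv (hD₁.trans (Finset.filter_subset _ _)), ?_, ?_⟩
    · rw [Finset.coe_insert]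
      refine hi.insert fun u hu _ => ?_
      have := (Finset.mem_filter.mp (hD₁ hu)).2.2
      exact ⟨this, fun hadj => this hadj.symm⟩
    · intro w hw
      by_cases hwv : w = v
      · exact .inl (by simp [hwv])
      by_cases hadj : G.Adj v w
      · exact .inr ⟨v, by simp, hadj, hmax w hw⟩
      rcases h w (by simp [hw, hwv, hadj]) with h | ⟨u, hu, h⟩
      · exact .inl (by simp [h])
      · exact .inr ⟨u, by simp [hu], h⟩

/-- If `G` has a dominating set `D` of bounded size and none of the three special graphs, then some
maximal independent set has bounded size. It extends the subset of `D` chosen greedily by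
decreasing independence number of the neighbourhood. -/
theorem exists_maximal_isIndepSet_ncard_le (n c : ℕ) : ∃ c' : ℕ, ∀ {V : Type} [Finite V]
    (G : SimpleGraph V) (D : Set V), IsDominating G D → D.ncard ≤ c →
    ¬ (starPendantG n).graph.IsIndContained G → ¬ (bicliqueG n).graph.IsIndContained G →
    ¬ (bistarG n).graph.IsIndContained G →
    ∃ I : Set V, Maximal G.IsIndepSet I ∧ I.ncard ≤ c' := by
  classical
  obtain ⟨M, hM⟩ := exists_indep_private_bound n
  refine ⟨c + c * M, fun {V} _ G D hD hDc hsp hbc hbs => ?_⟩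
  have hmax : ∀ v, ∃ C ⊆ G.neighborSet v, G.IsIndepSet C ∧
      ∀ T ⊆ G.neighborSet v, G.IsIndepSet T → T.ncard ≤ C.ncard := by
    intro v
    obtain ⟨C, hC, h⟩ := Set.exists_max_image {C | C ⊆ G.neighborSet v ∧ G.IsIndepSet C}
      Set.ncard (Set.toFinite _) ⟨∅, by simp⟩
    exact ⟨C, hC.1, hC.2, fun T hT hTi => h T ⟨hT, hTi⟩⟩
  choose C hCv hC hCmax using hmax
  obtain ⟨D₀, hD₀, hi, hgr⟩ := exists_greedy_indep G (fun v => (C v).ncard) D.toFinite.toFinset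
  obtain ⟨I, hI, hImax⟩ := exists_maximal_isIndepSet hi
  have hDcard : D.toFinite.toFinset.card ≤ c := by rwa [← Set.ncard_eq_toFinset_card D]
  -- For `w ∈ D` outside `D₀`, the set `E w` is the part of `I` that `w` is needed to dominate.
  let E : V → Set V := fun w =>
    {u ∈ I | G.Adj w u ∧ u ∉ D₀ ∧ w ∉ D₀}
  have hE : ∀ w ∈ D.toFinite.toFinset, (E w).ncard ≤ M := by
    intro w hw
    rcases hgr w hw with hw₀ | ⟨v, hv, hvw, hle⟩
    · have : E w = ∅ := Set.eq_empty_of_forall_notMem fun u hu => hu.2.2.2 hw₀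
      simp [this]
    · refine (hM G v w (C v) (E w) hsp hbc hbs hvw (hCv v) (hC v)
        (fun T hT hTi => (hCmax w T hT hTi).trans hle) (fun u hu => ⟨hu.2.1, fun hvu => ?_⟩)
        (fun h => h.2.2.1 hv) (hImax.prop.mono fun u hu => hu.1)).le
      exact hImax.prop (hI hv) hu.1 hvu.ne hvu
  have hcover : I ⊆ D₀ ∪ ⋃ w ∈ D.toFinite.toFinset, E w := by
    intro u hu
    by_cases hu₀ : u ∈ D₀
    · exact .inl hu₀
    obtain ⟨w, hw, huw⟩ := isDominating_iff.mp hD u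
    have hwD : w ∈ D.toFinite.toFinset := by simpa using hw
    refine .inr (Set.mem_biUnion (x := w) hwD ⟨hu, ?_, hu₀, fun hw₀ => ?_⟩)
    · refine huw.resolve_left ?_
      rintro rfl
      obtain ⟨v, hv, hvu, -⟩ := (hgr u hwD).resolve_left hu₀
      exact hImax.prop (hI hv) hu hvu.ne hvu
    · rcases huw with rfl | huw
      · exact hu₀ hw₀
      · exact hImax.prop (hI hw₀) hu huw.ne huw
  refine ⟨I, hImax, (Set.ncard_le_ncard hcover).trans ((Set.ncard_union_le _ _).trans
    (add_le_add ?_ ?_))⟩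
  · rw [Set.ncard_coe_finset]
    exact (Finset.card_le_card hD₀).trans hDcard
  · refine (Finset.set_ncard_biUnion_le _ _).trans ((Finset.sum_le_card_nsmul _ _ M hE).trans ?_)
    exact Nat.mul_le_mul_right M hDcard

/-! ### Bounding the upper irredundance number -/

/-- A large irredundant set contains a large clique or a large independent set. The private
neighbours of a clique form a clique or an independent set, up to passing to a subset, which gives
`CK_n` or `K_n^*`; a large independent set has a large intersection with some layer. -/
theorem exists_isIrredundant_ncard_le (n : ℕ) : ∃ c : ℕ, ∀ {V : Type} [Finite V]
    (G : SimpleGraph V), G.Connected → ¬ (starG n).graph.IsIndContained G →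
    ¬ (cliquePendantG n).graph.IsIndContained G → ¬ (pathG n).graph.IsIndContained G →
    ¬ (matchedCliquesG n).graph.IsIndContained G →
    ∀ S : Set V, IsIrredundant G S → S.ncard ≤ c := by
  choose N hN using fun d => star_or_cliquePendant_of_indep n d
  obtain ⟨R, hR⟩ := ramsey_adj n
  let b := ∑ d ∈ Finset.range n, N d + 1
  obtain ⟨c, hc⟩ := ramsey_adj ((R + 2) + b)
  refine ⟨c, fun {V} _ G hG hst hcp hpa hck S hS => ?_⟩
  by_contra! hSc
  obtain ⟨s, hs, hsS⟩ := exists_family_of_le_ncard hSc.le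
  obtain ⟨f, hf, hcl | hin⟩ := hc G s
  · -- The two additional members make every private neighbour different from its owner.
    have hinj : Function.Injective fun i => s (f (Fin.castAdd b i)) :=
      hs.comp (hf.injective.comp (Fin.castAdd_injective _ _))
    choose t ht ht' using fun i : Fin (R + 2) => isIrredundant_iff.mp hS _ (hsS (f (Fin.castAdd b i)))
    have hcl' : ∀ i j, i ≠ j → G.Adj (s (f (Fin.castAdd b i))) (s (f (Fin.castAdd b j))) :=
      fun i j hij => hcl _ _ (by simpa using hij)
    have hpriv : ∀ i j, i ≠ j → t i ≠ s (f (Fin.castAdd b j)) ∧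
        ¬ G.Adj (s (f (Fin.castAdd b j))) (t i) := fun i j hij =>
      ht' i _ (hsS _) (hinj.ne hij.symm)
    have htne : ∀ i, t i ≠ s (f (Fin.castAdd b i)) := by
      intro i h
      obtain ⟨j, hj⟩ := exists_ne i
      exact (hpriv i j hj.symm).2 (h ▸ hcl' j i hj)
    have hadj : ∀ i j, G.Adj (s (f (Fin.castAdd b i))) (t j) ↔ i = j := by
      intro i j
      constructor
      · intro h
        by_contra hij
        exact (hpriv j i (Ne.symm hij)).2 h
      · rintro rfl
        exact (ht i).resolve_left (htne i)
    obtain ⟨g, hg, hcl₂ | hin₂⟩ := hR G fun i => t (Fin.castAdd 2 i)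
    · refine hck (matchedCliques_isIndContained
        (fun i => s (f (Fin.castAdd b (Fin.castAdd 2 (g i))))) (fun i => t (Fin.castAdd 2 (g i)))
        (fun i j hij => hcl' _ _ ?_) hcl₂ (fun i j => ?_) fun i j h => ?_)
      · simpa [hg.injective.eq_iff] using hij
      · rw [hadj, Fin.castAdd_inj, hg.injective.eq_iff]
      · by_cases hij : i = j
        · exact htne _ (hij ▸ h.symm)
        · exact (hpriv _ _ (by simpa [hg.injective.eq_iff] using Ne.symm hij)).1 h.symm
    · refine hcp (cliquePendant_isIndContained
        (fun i => s (f (Fin.castAdd b (Fin.castAdd 2 (g i))))) (fun i => t (Fin.castAdd 2 (g i)))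
        (fun i j hij => hcl' _ _ ?_) hin₂ fun i j => ?_)
      · simpa [hg.injective.eq_iff] using hij
      · rw [hadj, Fin.castAdd_inj, hg.injective.eq_iff]
  · obtain ⟨r⟩ := hG.nonempty
    set x : Fin b → V := fun i => s (f (Fin.natAdd (R + 2) i)) with hx
    have hxinj : Function.Injective x := hs.comp (hf.injective.comp (Fin.natAdd_injective _ _))
    have hlayer : ∀ d ∈ Finset.range n, {v ∈ Set.range x | G.dist r v = d}.ncard ≤ N d := by
      intro d _
      by_contra! h
      obtain ⟨y, hy, hyx⟩ := exists_family_of_le_ncard h.le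
      refine (hN d G r y hG hy (fun i => (hyx i).2) fun i j => ?_).elim hst hcp
      obtain ⟨i', hi'⟩ := (hyx i).1
      obtain ⟨j', hj'⟩ := (hyx j).1
      exact hi' ▸ hj' ▸ hin _ _
    have hsub : Set.range x ⊆ ⋃ d ∈ Finset.range n, {v ∈ Set.range x | G.dist r v = d} := by
      intro v hv
      exact Set.mem_biUnion (x := G.dist r v) (by simpa using dist_lt_of_not_path hG hpa r v)
        ⟨hv, rfl⟩
    have := (Set.ncard_le_ncard hsub).trans
      ((Finset.set_ncard_biUnion_le _ _).trans (Finset.sum_le_sum hlayer))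
    rw [Set.ncard_range_of_injective hxinj, Nat.card_fin] at this
    omega

/-! ### Characterisation of the bounded families -/

theorem exists_familyLE_of_mem_boundedFamilies {μ : FinGraph → ℕ} {ℋ : Set FinGraph}
    (F : ℕ → Set FinGraph) (h : ∀ c, ∃ n, 0 < n ∧ ∀ H ∈ F n, H.graph.Connected ∧ c ≤ μ H)
    (hℋ : ℋ ∈ boundedFamilies μ) : ∃ n, 0 < n ∧ FamilyLE ℋ (F n) := by
  obtain ⟨c, hc⟩ := hℋ
  obtain ⟨n, hn, hF⟩ := h c
  refine ⟨n, hn, fun H hH => ?_⟩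
  by_contra hfree
  exact (hF H hH).2.not_gt (hc H (hF H hH).1 hfree)

theorem mem_boundedFamilies_of_familyLE {μ : FinGraph → ℕ} {ℋ : Set FinGraph}
    {F : Set FinGraph} (hF : FamilyLE ℋ F)
    (h : ∃ c, ∀ G : FinGraph, G.graph.Connected → (∀ H ∈ F, ¬ Prec H G) → μ G ≤ c) :
    ℋ ∈ boundedFamilies μ := by
  obtain ⟨c, hc⟩ := h
  refine ⟨c + 1, fun G hG hfree => Nat.lt_succ_of_le (hc G hG fun H hH hHG => ?_)⟩
  obtain ⟨H₁, hH₁, hle⟩ := hF H hH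
  exact hfree ⟨H₁, hH₁, SimpleGraph.IsIndContained.trans hle hHG⟩

theorem mem_boundedFamilies_ir_iff (ℋ : Set FinGraph) : ℋ ∈ boundedFamilies ir ↔
    ∃ n : ℕ, 0 < n ∧ FamilyLE ℋ {starPendantG n, cliquePendantG n, pathG n} := by
  constructor
  · refine exists_familyLE_of_mem_boundedFamilies
      (fun n => {starPendantG n, cliquePendantG n, pathG n}) fun c => ?_
    -- `P_{3m}` has a packing of size `m`, and a packing of size `2c + 1 > 0` gives `c ≤ ir`.
    refine ⟨3 * (2 * c + 1), by omega, ?_⟩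
    rintro _ (rfl | rfl | rfl)
    · refine ⟨starPendant_connected (by omega), ?_⟩
      have := le_two_mul_ir_of_packing _
        (addPendants_packing (H := completeBipartiteGraph (Fin 1) (Fin (3 * (2 * c + 1))))
          Sum.inr_injective)
      change c ≤ ir (FinGraph.of _)
      omega
    · refine ⟨cliquePendant_connected (by omega), ?_⟩
      have := le_two_mul_ir_of_packing _
        (addPendants_packing (H := SimpleGraph.completeGraph (Fin (3 * (2 * c + 1))))
          Function.injective_id)
      change c ≤ ir (FinGraph.of _)
      omega
    · refine ⟨path_connected (by omega), ?_⟩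
      have := le_two_mul_ir_of_packing _ (path_packing (n := 2 * c + 1))
      change c ≤ ir (FinGraph.of _)
      omega
  · rintro ⟨n, -, hF⟩
    obtain ⟨c, hc⟩ := exists_dominating_ncard_le n
    refine mem_boundedFamilies_of_familyLE hF ⟨c, fun G hG hfree => ?_⟩
    have := G.finite
    obtain ⟨D, hD, hDc⟩ := hc G.graph hG (hfree _ (by simp)) (hfree _ (by simp))
      (hfree _ (by simp))
    exact (ir_le_of_isDominating hD).trans hDc

theorem mem_boundedFamilies_indepDom_iff (ℋ : Set FinGraph) : ℋ ∈ boundedFamilies indepDom ↔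
    ∃ n : ℕ, 0 < n ∧ FamilyLE ℋ
      {starPendantG n, cliquePendantG n, pathG n, bicliqueG n, bistarG n} := by
  constructor
  · refine exists_familyLE_of_mem_boundedFamilies
      (fun n => {starPendantG n, cliquePendantG n, pathG n, bicliqueG n, bistarG n}) fun c => ?_
    refine ⟨3 * (c + 1), by omega, ?_⟩
    rintro _ (rfl | rfl | rfl | rfl | rfl)
    · exact ⟨starPendant_connected (by omega), le_trans (by omega) (le_indepDom_of_packing _
        (addPendants_packing Sum.inr_injective))⟩
    · exact ⟨cliquePendant_connected (by omega), le_trans (by omega) (le_indepDom_of_packing _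
        (addPendants_packing Function.injective_id))⟩
    · exact ⟨path_connected (by omega), le_trans (by omega) (le_indepDom_of_packing _
        (path_packing (n := c + 1)))⟩
    · exact ⟨biclique_connected (by omega), le_trans (by omega) (le_indepDom_biclique _)⟩
    · exact ⟨bistar_connected, le_trans (by omega) (le_indepDom_bistar _)⟩
  · rintro ⟨n, -, hF⟩
    obtain ⟨c, hc⟩ := exists_dominating_ncard_le n
    obtain ⟨c', hc'⟩ := exists_maximal_isIndepSet_ncard_le n c
    refine mem_boundedFamilies_of_familyLE hF ⟨c', fun G hG hfree => ?_⟩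
    have := G.finite
    obtain ⟨D, hD, hDc⟩ := hc G.graph hG (hfree _ (by simp)) (hfree _ (by simp))
      (hfree _ (by simp))
    obtain ⟨I, hI, hIc⟩ := hc' G.graph D hD hDc (hfree _ (by simp)) (hfree _ (by simp))
      (hfree _ (by simp))
    have h : indepDom G ≤ I.ncard := Nat.sInf_le ⟨I, hI, rfl⟩
    exact h.trans hIc

theorem exists_familyLE_of_mem_boundedFamilies_upperDom {ℋ : Set FinGraph}
    (hℋ : ℋ ∈ boundedFamilies upperDom) : ∃ n : ℕ, 0 < n ∧
      FamilyLE ℋ {starG n, cliquePendantG n, pathG n, matchedCliquesG n} := by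
  refine exists_familyLE_of_mem_boundedFamilies
    (fun n => {starG n, cliquePendantG n, pathG n, matchedCliquesG n}) (fun c => ?_) hℋ
  refine ⟨3 * (c + 1), by omega, ?_⟩
  rintro _ (rfl | rfl | rfl | rfl)
  · exact ⟨star_connected (by omega), le_trans (by omega) (le_upperDom_star (by omega))⟩
  · exact ⟨cliquePendant_connected (by omega), le_trans (by omega) (le_upperDom_of_packing _
      (addPendants_packing Function.injective_id))⟩
  · exact ⟨path_connected (by omega), le_trans (by omega) (le_upperDom_of_packing _
      (path_packing (n := c + 1)))⟩
  · exact ⟨matchedCliques_connected (by omega),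
      le_trans (by omega) (le_upperDom_matchedCliques _)⟩

theorem mem_boundedFamilies_upperIR_of_familyLE {ℋ : Set FinGraph} {n : ℕ}
    (hF : FamilyLE ℋ {starG n, cliquePendantG n, pathG n, matchedCliquesG n}) :
    ℋ ∈ boundedFamilies upperIR := by
  obtain ⟨c, hc⟩ := exists_isIrredundant_ncard_le n
  refine mem_boundedFamilies_of_familyLE hF ⟨c, fun G hG hfree => csSup_le' ?_⟩
  have := G.finite
  rintro _ ⟨S, hS, rfl⟩
  exact hc G.graph hG (hfree _ (by simp)) (hfree _ (by simp)) (hfree _ (by simp))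
    (hfree _ (by simp)) S hS.prop

theorem mem_boundedFamilies_upperDom_of_upperIR {ℋ : Set FinGraph}
    (hℋ : ℋ ∈ boundedFamilies upperIR) : ℋ ∈ boundedFamilies upperDom :=
  hℋ.imp fun _ hc G hG hfree => (upperDom_le_upperIR G).trans_lt (hc G hG hfree)

end DominationChain

open DominationChain in
theorem mainTheorem1 (ℋ : Set FinGraph) :
    (ℋ ∈ boundedFamilies ir ↔
      ∃ n : ℕ, 0 < n ∧ FamilyLE ℋ {starPendantG n, cliquePendantG n, pathG n}) ∧
    (ℋ ∈ boundedFamilies indepDom ↔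
      ∃ n : ℕ, 0 < n ∧
        FamilyLE ℋ {starPendantG n, cliquePendantG n, pathG n, bicliqueG n, bistarG n}) ∧
    ((ℋ ∈ boundedFamilies upperIR ↔ ℋ ∈ boundedFamilies upperDom) ∧
      (ℋ ∈ boundedFamilies upperDom ↔
        ∃ n : ℕ, 0 < n ∧
          FamilyLE ℋ {starG n, cliquePendantG n, pathG n, matchedCliquesG n})) := by
  have back : (∃ n : ℕ, 0 < n ∧ FamilyLE ℋ
      {starG n, cliquePendantG n, pathG n, matchedCliquesG n}) → ℋ ∈ boundedFamilies upperIR := by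
    rintro ⟨n, -, hF⟩
    exact mem_boundedFamilies_upperIR_of_familyLE hF
  exact ⟨mem_boundedFamilies_ir_iff ℋ, mem_boundedFamilies_indepDom_iff ℋ,
    ⟨mem_boundedFamilies_upperDom_of_upperIR,
      fun h => back (exists_familyLE_of_mem_boundedFamilies_upperDom h)⟩,
    exists_familyLE_of_mem_boundedFamilies_upperDom,
    fun h => mem_boundedFamilies_upperDom_of_upperIR (back h)⟩
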